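/- Let $\eta:\mathbb{R}\to\mathbb{R}$ be a smooth function such that $\eta$ and $\eta'$ are bounded and $\inf_{x}(1+\eta(x))>0$; in particular $\eta=\eta_\varepsilon$ may be the profile of the Amick--Kirchgässner line solitary wave of the water-waves system, for any $\varepsilon$ for which it exists. Let $\mathcal D=\{(x,z)\in\mathbb{R}^2:\,-1<z<\eta(x)\}$. For $k\in\mathbb{R}$ and $u\in H^{1/2}(\mathbb{R};\mathbb{C})$ the elliptic problem $$(\partial_x^2+\partial_z^2-k^2)\phi=0\ \text{ in }\mathcal D,\qquad \phi(x,\eta(x))=u(x),\qquad \partial_z\phi(x,-1)=0$$ has a unique variational solution $\phi=\phi_k^u\in H^1(\mathcal D)$, that is, $\phi$ has trace $u$ on $\{z=\eta(x)\}$ and $\int_{\mathcal D}\nabla\phi\cdot\overline{\nabla w}+k^2\phi\,\overline w\,dx\,dz=0$ for all $w\in H^1(\mathcal D)$ with zero trace on $\{z=\eta(x)\}$. The transverse-Fourier Dirichlet--Neumann operator $$G_ku=\sqrt{1+(\eta')^2}\,\nabla\phi_k^u\cdot n=\partial_z\phi_k^u(x,\eta(x))-\eta'(x)\,\partial_x\phi_k^u(x,\eta(x))$$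 ($G_k=G_{\varepsilon,k}$ if $\eta=\eta_\varepsilon$) is understood as a weak conormal derivative, i.e. $G_ku$ is the (unique, well defined) antilinear functional on $H^{1/2}(\mathbb{R})$ with $(G_ku,v)=\int_{\mathcal D}\nabla\phi_k^u\cdot\overline{\nabla w}+k^2\phi_k^u\,\overline{w}\,dx\,dz$ for every $v\in H^{1/2}(\mathbb{R})$ and every $w\in H^1(\mathcal D)$ with trace $v$ on $\{z=\eta(x)\}$; $G_k$ is linear in $u$. Write $(u,G_kv)=\overline{(G_kv,u)}$, $D=-i\partial_x$, and $$N_k(u)=\Big|\frac{\sqrt{D^2+k^2}}{(1+\sqrt{D^2+k^2})^{1/2}}\,u\Big|_{L^2(\mathbb{R})}.$$ Then: i) $G_k$ is symmetric: $(G_ku,v)=(u,G_kv)$ for all $k\in\mathbb{R}$ and $u,v\in H^{1/2}(\mathbb{R})$ (in particular $(G_ku,u)$ is real). ii) If $|k_1|>|k_2|$, then $(G_{k_1}u,u)>(G_{k_2}u,u)$ for all $u\in H^{1/2}(\mathbb{R})$, $u\neq0$. iii) There exist $c>0$ and $C>0$, depending only on $\eta$, such that for every $k\in\mathbb{R}$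 $$|(G_ku,v)|\le C\,N_k(u)\,N_k(v)\quad\text{and}\quad (G_ku,u)\ge c\,N_k(u)^2\qquad\text{for all } u,v\in H^{1/2}(\mathbb{R}).$$ -/

import Mathlib

open MeasureTheory Filter Topology ComplexConjugate FourierTransform
open scoped ContDiff

noncomputable section

/-- The Sobolev space `H^{1/2}(ℝ)` of complex-valued functions, as a subspace of `L²(ℝ)`. -/
def Hhalf : Submodule ℂ (Lp ℂ 2 (volume : Measure ℝ)) where
  carrier := {u | TemperedDistribution.MemSobolev (1 / 2) 2 (u : TemperedDistribution ℝ ℂ)}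
  add_mem' {u v} hu hv := by
    have h : ((u + v : Lp ℂ 2 (volume : Measure ℝ)) : TemperedDistribution ℝ ℂ)
        = (u : TemperedDistribution ℝ ℂ) + (v : TemperedDistribution ℝ ℂ) :=
      map_add (Lp.toTemperedDistributionCLM ℂ (volume : Measure ℝ) 2) u v
    simpa only [Set.mem_ofPred_eq, h] using hu.add hv
  zero_mem' := by
    have h : ((0 : Lp ℂ 2 (volume : Measure ℝ)) : TemperedDistribution ℝ ℂ) = 0 :=
      map_zero (Lp.toTemperedDistributionCLM ℂ (volume : Measure ℝ) 2)
    simpa only [Set.mem_ofPred_eq, h] using TemperedDistribution.memSobolev_fun_zero ℝ ℂ (1 / 2) 2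
  smul_mem' c u hu := by
    have h : ((c • u : Lp ℂ 2 (volume : Measure ℝ)) : TemperedDistribution ℝ ℂ)
        = c • (u : TemperedDistribution ℝ ℂ) :=
      map_smul (Lp.toTemperedDistributionCLM ℂ (volume : Measure ℝ) 2) c u
    simpa only [Set.mem_ofPred_eq, h] using hu.smul c

/-- The norm `| √(D² + k²) (1 + √(D² + k²))^{-1/2} u |_{L²}`, where `D = -i ∂ₓ`, computed on the
Fourier side by Plancherel's identity. Since `𝓕 u (ξ) = ∫ e^{-2πixξ} u(x) dx`, the operator `D`
is the multiplication by `2πξ`. -/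
def dnNorm (k : ℝ) (u : Hhalf) : ℝ :=
  (eLpNorm (fun ξ : ℝ =>
    ((√((2 * Real.pi * ξ) ^ 2 + k ^ 2) / √(1 + √((2 * Real.pi * ξ) ^ 2 + k ^ 2)) : ℝ) : ℂ)
      * (𝓕 (u : Lp ℂ 2 (volume : Measure ℝ)) : Lp ℂ 2 (volume : Measure ℝ)) ξ) 2 volume).toReal

/-- The fluid domain `{(x, z) : -1 < z < η(x)}`. -/
def fluidDomain (η : ℝ → ℝ) : Set (ℝ × ℝ) := {p | -1 < p.2 ∧ p.2 < η p.1}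

/-- `g` is the weak derivative of `f` in the direction `e` in the fluid domain. -/
def IsWeakDeriv (η : ℝ → ℝ) (e : ℝ × ℝ)
    (f g : Lp ℂ 2 (volume.restrict (fluidDomain η))) : Prop :=
  ∀ ψ : ℝ × ℝ → ℝ, ContDiff ℝ ∞ ψ → HasCompactSupport ψ → tsupport ψ ⊆ fluidDomain η →
    ∫ p in fluidDomain η, fderiv ℝ ψ p e • f p = - ∫ p in fluidDomain η, ψ p • g p

/-- The Sobolev space `H¹` of the fluid domain: square integrable functions `val` with square
integrable weak partial derivatives `dx`, `dz`. -/
@[ext] structure FluidH1 (η : ℝ → ℝ) where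
  val : Lp ℂ 2 (volume.restrict (fluidDomain η))
  dx : Lp ℂ 2 (volume.restrict (fluidDomain η))
  dz : Lp ℂ 2 (volume.restrict (fluidDomain η))
  isWeakDeriv_dx : IsWeakDeriv η (1, 0) val dx
  isWeakDeriv_dz : IsWeakDeriv η (0, 1) val dz

/-- `u` is the trace `w(x, η(x))` of `w ∈ H¹` on the free surface: smooth compactly supported
functions on the plane converge to `w` in `H¹` of the fluid domain, while their restrictions to
the surface converge to `u` in `L²(ℝ)`. -/
def HasSurfaceTrace {η : ℝ → ℝ} (w : FluidH1 η) (u : Lp ℂ 2 (volume : Measure ℝ)) : Prop :=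
  ∃ ψ : ℕ → ℝ × ℝ → ℂ,
    (∀ n, ContDiff ℝ ∞ (ψ n) ∧ HasCompactSupport (ψ n)) ∧
    Tendsto (fun n => eLpNorm (fun p => ψ n p - w.val p) 2
      (volume.restrict (fluidDomain η))) atTop (𝓝 0) ∧
    Tendsto (fun n => eLpNorm (fun p => fderiv ℝ (ψ n) p (1, 0) - w.dx p) 2
      (volume.restrict (fluidDomain η))) atTop (𝓝 0) ∧
    Tendsto (fun n => eLpNorm (fun p => fderiv ℝ (ψ n) p (0, 1) - w.dz p) 2
      (volume.restrict (fluidDomain η))) atTop (𝓝 0) ∧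
    Tendsto (fun n => eLpNorm (fun x => ψ n (x, η x) - u x) 2 volume) atTop (𝓝 0)

/-- The sesquilinear form `∫ ∇φ · conj(∇w) + k² φ conj(w)` over the fluid domain. -/
def helmholtzForm {η : ℝ → ℝ} (k : ℝ) (φ w : FluidH1 η) : ℂ :=
  ∫ p in fluidDomain η,
    (φ.dx p * conj (w.dx p) + φ.dz p * conj (w.dz p) + (k : ℂ) ^ 2 * (φ.val p * conj (w.val p)))

/-- `φ` is the variational solution in `H¹` of `(∂ₓ² - k² + ∂_z²) φ = 0` in the fluid domain,
`φ(x, η(x)) = u(x)` on the surface and `∂_z φ(x, -1) = 0` at the bottom. The test functions vanish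
on the surface but are free at the bottom, which encodes the Neumann condition there. -/
def IsDirichletSolution (η : ℝ → ℝ) (k : ℝ) (u : Hhalf) (φ : FluidH1 η) : Prop :=
  HasSurfaceTrace φ (u : Lp ℂ 2 (volume : Measure ℝ)) ∧
    ∀ w : FluidH1 η, HasSurfaceTrace w 0 → helmholtzForm k φ w = 0

/-- `G` is the map which sends `u` to the weak conormal derivative
`√(1 + η'²) ∇φ · n = ∂_z φ - η' ∂ₓφ` on the surface of the solution `φ` with Dirichlet data `u`.
This is an element of the antidual `H^{-1/2}` of `H^{1/2}`: with `Δφ = k² φ` and `∂_z φ = 0` at the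
bottom, the weak conormal derivative is by definition the functional that sends the trace `v` of
any `w ∈ H¹` to `∫ ∇φ · conj(∇w) + Δφ conj(w)`. -/
def IsDirichletNeumann (η : ℝ → ℝ) (k : ℝ) (G : Hhalf →ₗ[ℂ] Hhalf →ₗ⋆[ℂ] ℂ) : Prop :=
  ∀ (u : Hhalf) (φ : FluidH1 η), IsDirichletSolution η k u φ →
    ∀ (v : Hhalf) (w : FluidH1 η), HasSurfaceTrace w (v : Lp ℂ 2 (volume : Measure ℝ)) →
      G u v = helmholtzForm k φ w

/-- The Dirichlet-Neumann operator at transverse frequency `k`, for the surface `z = η(x)`;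
`dirichletNeumann η k u v` is the pairing `(G_k u, v)`, linear in `u` and antilinear in `v`. -/
def dirichletNeumann (η : ℝ → ℝ) (k : ℝ) : Hhalf →ₗ[ℂ] Hhalf →ₗ⋆[ℂ] ℂ :=
  Classical.epsilon (IsDirichletNeumann η k)

end

noncomputable section

/-! The form `(G_k u, v)` is an inner product of energy vectors `(∇φ, kφ)`, and `(G_k u, u)` is the
least energy among all extensions of `u` to the fluid domain (Dirichlet's principle). Well-posedness
is an orthogonal projection, made possible by a Poincaré inequality in the vertical direction.
Symmetry is the Hermitian symmetry of the inner product. Monotonicity follows by inserting the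
`k₁`-solution as a competitor for `k₂`; it is strict because a function that vanishes in the fluid
has zero trace.

By minimality, the two-sided bounds need a lower estimate for every extension and an upper estimate
for a single one. Both are made after the shear `(x, z) ↦ (x, z - η x)`, which preserves area and
distorts energies by a factor depending only on the bound of `η'`. A Fourier transform in `x` then
leaves a problem in one variable for each frequency `m = √((2πξ)² + k²)`. The lower estimate is a
one-dimensional trace inequality with its free parameter equal to `m` (`dnMultiplier_sq_mul_le`).
The upper estimate uses the extension with symbol `exp(-m² s²)`
(`lintegral_gaussianSymbol_energy_le`): over a strip of bounded height its energy at frequency `m`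
is at most a constant times `m² / (1 + m)`, uniformly in `k`.

Both estimates start from smooth functions. `dnEnergy_le_of_mem_traceGraph` reaches all extensions
by Fatou's lemma, and `PoincareInequality.exists_extension_of_dense` reaches all of `H^{1/2}` by
density. The results are assembled in `dirichletNeumann_properties_of_bounds`. -/

/-! ### The trace operator as a closed graph in a product of `L²` spaces. -/

/-- Square integrable functions on the fluid domain. -/
abbrev FluidL2 (η : ℝ → ℝ) := Lp ℂ 2 (volume.restrict (fluidDomain η))

/-- Triples consisting of a function and its two partial derivatives, with a surface value. -/
abbrev TraceData (η : ℝ → ℝ) :=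
  FluidL2 η × FluidL2 η × FluidL2 η × Lp ℂ 2 (volume : Measure ℝ)

/-- The data of the smooth compactly supported functions on the plane. -/
def smoothTraceData (η : ℝ → ℝ) : Submodule ℂ (TraceData η) where
  carrier := {x | ∃ ψ : ℝ × ℝ → ℂ, ContDiff ℝ ∞ ψ ∧ HasCompactSupport ψ ∧
    x.1 =ᵐ[volume.restrict (fluidDomain η)] ψ ∧
    x.2.1 =ᵐ[volume.restrict (fluidDomain η)] (fun p => fderiv ℝ ψ p (1, 0)) ∧
    x.2.2.1 =ᵐ[volume.restrict (fluidDomain η)] (fun p => fderiv ℝ ψ p (0, 1)) ∧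
    x.2.2.2 =ᵐ[volume] (fun t => ψ (t, η t))}
  add_mem' := by
    rintro x y ⟨ψ, hψ, hψc, h1, h2, h3, h4⟩ ⟨φ, hφ, hφc, g1, g2, g3, g4⟩
    have hd : ∀ p, fderiv ℝ (ψ + φ) p = fderiv ℝ ψ p + fderiv ℝ φ p := fun p =>
      fderiv_add (hψ.differentiable (by simp) p) (hφ.differentiable (by simp) p)
    refine ⟨ψ + φ, hψ.add hφ, hψc.add hφc, ?_, ?_, ?_, ?_⟩
    · filter_upwards [Lp.coeFn_add x.1 y.1, h1, g1] with p e a b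
      exact e.trans (by simp [a, b])
    · filter_upwards [Lp.coeFn_add x.2.1 y.2.1, h2, g2] with p e a b
      exact e.trans (by simp [a, b, hd])
    · filter_upwards [Lp.coeFn_add x.2.2.1 y.2.2.1, h3, g3] with p e a b
      exact e.trans (by simp [a, b, hd])
    · filter_upwards [Lp.coeFn_add x.2.2.2 y.2.2.2, h4, g4] with p e a b
      exact e.trans (by simp [a, b])
  zero_mem' := by
    refine ⟨0, contDiff_const, HasCompactSupport.zero, ?_, ?_, ?_, ?_⟩
    · exact Lp.coeFn_zero _ _ _
    · filter_upwards [Lp.coeFn_zero ℂ 2 (volume.restrict (fluidDomain η))] with p hp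
      exact hp.trans (by simp)
    · filter_upwards [Lp.coeFn_zero ℂ 2 (volume.restrict (fluidDomain η))] with p hp
      exact hp.trans (by simp)
    · exact Lp.coeFn_zero _ _ _
  smul_mem' := by
    rintro c x ⟨ψ, hψ, hψc, h1, h2, h3, h4⟩
    have hd : ∀ p, fderiv ℝ (c • ψ) p = c • fderiv ℝ ψ p := fun p =>
      fderiv_const_smul (hψ.differentiable (by simp) p) c
    refine ⟨c • ψ, hψ.const_smul c, hψc.smul_left (f := fun _ => c), ?_, ?_, ?_, ?_⟩
    · filter_upwards [Lp.coeFn_smul c x.1, h1] with p e a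
      exact e.trans (by simp [a])
    · filter_upwards [Lp.coeFn_smul c x.2.1, h2] with p e a
      exact e.trans (by simp [a, hd])
    · filter_upwards [Lp.coeFn_smul c x.2.2.1, h3] with p e a
      exact e.trans (by simp [a, hd])
    · filter_upwards [Lp.coeFn_smul c x.2.2.2, h4] with p e a
      exact e.trans (by simp [a])

/-- The graph of the trace operator. -/
def traceGraph (η : ℝ → ℝ) : Submodule ℂ (TraceData η) := (smoothTraceData η).topologicalClosure

theorem isClosed_traceGraph (η : ℝ → ℝ) : IsClosed (traceGraph η : Set (TraceData η)) :=
  Submodule.isClosed_topologicalClosure _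

/-- A closed condition need only be checked on smooth compactly supported functions; the weak
derivative identities and both integral inequalities are obtained in this way. -/
theorem traceGraph_induction {η : ℝ → ℝ} {P : TraceData η → Prop} (hP : IsClosed {x | P x})
    (h : ∀ x ∈ smoothTraceData η, P x) {x : TraceData η} (hx : x ∈ traceGraph η) : P x :=
  closure_minimal (s := (smoothTraceData η : Set (TraceData η))) h hP hx

theorem memLp_restrict_of_continuous {η : ℝ → ℝ} {ψ : ℝ × ℝ → ℂ} (hψ : Continuous ψ)
    (hc : HasCompactSupport ψ) : MemLp ψ 2 (volume.restrict (fluidDomain η)) :=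
  (hψ.memLp_of_hasCompactSupport hc).restrict _

theorem HasCompactSupport.comp_graph {E : Type*} [Zero E] {η : ℝ → ℝ} {ψ : ℝ × ℝ → E}
    (hc : HasCompactSupport ψ) : HasCompactSupport (fun t => ψ (t, η t)) := by
  refine HasCompactSupport.intro (hc.isCompact.image continuous_fst) fun t ht => ?_
  by_contra h
  exact ht ⟨(t, η t), subset_tsupport _ h, rfl⟩

theorem continuous_fderiv_apply_of_contDiff {ψ : ℝ × ℝ → ℂ} (hψ : ContDiff ℝ ∞ ψ) (e : ℝ × ℝ) :
    Continuous fun p => fderiv ℝ ψ p e :=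
  (hψ.continuous_fderiv (by simp)).clm_apply continuous_const

theorem memLp_trace {η : ℝ → ℝ} (hη : Continuous η) {ψ : ℝ × ℝ → ℂ} (hψ : Continuous ψ)
    (hc : HasCompactSupport ψ) : MemLp (fun t => ψ (t, η t)) 2 (volume : Measure ℝ) :=
  Continuous.memLp_of_hasCompactSupport (by fun_prop) hc.comp_graph

theorem tendsto_toLp_iff {α : Type*} [MeasurableSpace α] {μ : Measure α} {f : ℕ → α → ℂ}
    (hf : ∀ n, MemLp (f n) 2 μ) (g : Lp ℂ 2 μ) :
    Tendsto (fun n => (hf n).toLp (f n)) atTop (𝓝 g) ↔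
      Tendsto (fun n => eLpNorm (fun p => f n p - g p) 2 μ) atTop (𝓝 0) := by
  rw [Lp.tendsto_Lp_iff_tendsto_eLpNorm']
  refine tendsto_congr fun n => eLpNorm_congr_ae ?_
  filter_upwards [(hf n).coeFn_toLp] with p hp
  simp [hp]

/-- The four `L²` limits together are one limit in the product space, which is metrizable, so that
approximating sequences describe exactly the closure. -/
theorem hasSurfaceTrace_iff {η : ℝ → ℝ} (hη : Continuous η) (w : FluidH1 η)
    (u : Lp ℂ 2 (volume : Measure ℝ)) :
    HasSurfaceTrace w u ↔ (w.val, w.dx, w.dz, u) ∈ traceGraph η := by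
  constructor
  · rintro ⟨ψ, hψ, h1, h2, h3, h4⟩
    have m1 := fun n => memLp_restrict_of_continuous (η := η) (hψ n).1.continuous (hψ n).2
    have m2 := fun n => memLp_restrict_of_continuous (η := η)
      (continuous_fderiv_apply_of_contDiff (hψ n).1 (1, 0)) ((hψ n).2.fderiv_apply ℝ _)
    have m3 := fun n => memLp_restrict_of_continuous (η := η)
      (continuous_fderiv_apply_of_contDiff (hψ n).1 (0, 1)) ((hψ n).2.fderiv_apply ℝ _)
    have m4 := fun n => memLp_trace hη (hψ n).1.continuous (hψ n).2
    refine mem_closure_of_tendsto (((tendsto_toLp_iff m1 _).2 h1).prodMk_nhds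
      (((tendsto_toLp_iff m2 _).2 h2).prodMk_nhds (((tendsto_toLp_iff m3 _).2 h3).prodMk_nhds
        ((tendsto_toLp_iff m4 _).2 h4)))) (Eventually.of_forall fun n => ?_)
    exact ⟨ψ n, (hψ n).1, (hψ n).2, (m1 n).coeFn_toLp, (m2 n).coeFn_toLp, (m3 n).coeFn_toLp,
      (m4 n).coeFn_toLp⟩
  · intro h
    obtain ⟨x, hx, hlim⟩ := mem_closure_iff_seq_limit.1 h
    choose ψ hψ hψc h1 h2 h3 h4 using hx
    have l1 := (continuous_fst.tendsto _).comp hlim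
    have l2 := ((continuous_fst.comp continuous_snd).tendsto _).comp hlim
    have l3 := ((continuous_fst.comp (continuous_snd.comp continuous_snd)).tendsto _).comp hlim
    have l4 := ((continuous_snd.comp (continuous_snd.comp continuous_snd)).tendsto _).comp hlim
    refine ⟨ψ, fun n => ⟨hψ n, hψc n⟩, ?_, ?_, ?_, ?_⟩
    · refine ((Lp.tendsto_Lp_iff_tendsto_eLpNorm' _ _).1 l1).congr fun n => eLpNorm_congr_ae ?_
      filter_upwards [h1 n] with p hp
      simp [hp]
    · refine ((Lp.tendsto_Lp_iff_tendsto_eLpNorm' _ _).1 l2).congr fun n => eLpNorm_congr_ae ?_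
      filter_upwards [h2 n] with p hp
      simp [hp]
    · refine ((Lp.tendsto_Lp_iff_tendsto_eLpNorm' _ _).1 l3).congr fun n => eLpNorm_congr_ae ?_
      filter_upwards [h3 n] with p hp
      simp [hp]
    · refine ((Lp.tendsto_Lp_iff_tendsto_eLpNorm' _ _).1 l4).congr fun n => eLpNorm_congr_ae ?_
      filter_upwards [h4 n] with p hp
      simp [hp]

theorem continuous_integral_smul {α : Type*} [MeasurableSpace α] {μ : Measure α} {ψ : α → ℝ}
    (hψ : MemLp ψ 2 μ) : Continuous fun f : Lp ℂ 2 μ => ∫ p, ψ p • f p ∂μ := by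
  have h : (fun f : Lp ℂ 2 μ => ∫ p, ψ p • f p ∂μ)
      = fun f => inner ℂ (hψ.ofReal.toLp (fun p => (ψ p : ℂ))) f := by
    ext f
    rw [L2.inner_def]
    refine integral_congr_ae ?_
    filter_upwards [(hψ.ofReal (K := ℂ)).coeFn_toLp] with p hp
    have hp' : (hψ.ofReal.toLp (fun p => (ψ p : ℂ))) p = (ψ p : ℂ) := hp
    simp [hp', mul_comm]
  rw [h]
  fun_prop

theorem isClosed_isWeakDeriv (η : ℝ → ℝ) (e : ℝ × ℝ) :
    IsClosed {x : FluidL2 η × FluidL2 η | IsWeakDeriv η e x.1 x.2} := by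
  simp only [IsWeakDeriv, Set.ofPred_forall]
  refine isClosed_iInter fun ψ => isClosed_iInter fun hψ => isClosed_iInter fun hψc =>
    isClosed_iInter fun _ => ?_
  have h1 : MemLp (fun p => fderiv ℝ ψ p e) 2 (volume.restrict (fluidDomain η)) :=
    (Continuous.memLp_of_hasCompactSupport
      ((hψ.continuous_fderiv (by simp)).clm_apply continuous_const)
      (hψc.fderiv_apply ℝ _)).restrict _
  have h2 : MemLp ψ 2 (volume.restrict (fluidDomain η)) :=
    (hψ.continuous.memLp_of_hasCompactSupport hψc).restrict _
  exact isClosed_eq ((continuous_integral_smul h1).comp continuous_fst)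
    ((continuous_integral_smul h2).comp continuous_snd).neg

/-- The test function is supported inside the domain, so both integrals extend to the whole plane,
where integration by parts has no boundary term. -/
theorem isWeakDeriv_of_contDiff {η : ℝ → ℝ} {e : ℝ × ℝ} {φ : ℝ × ℝ → ℂ} (hφ : ContDiff ℝ ∞ φ)
    {f g : FluidL2 η} (hf : f =ᵐ[volume.restrict (fluidDomain η)] φ)
    (hg : g =ᵐ[volume.restrict (fluidDomain η)] fun p => fderiv ℝ φ p e) :
    IsWeakDeriv η e f g := by
  intro ψ hψ hψc hψs
  have e1 : ∫ p in fluidDomain η, fderiv ℝ ψ p e • f p = ∫ p, fderiv ℝ ψ p e • φ p := by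
    refine Eq.trans (integral_congr_ae (hf.mono fun p hp => ?_))
      (setIntegral_eq_integral_of_forall_compl_eq_zero (s := fluidDomain η)
        (f := fun p => fderiv ℝ ψ p e • φ p) ?_)
    · simp only [hp]
    · intro p hp
      have : p ∉ tsupport (fderiv ℝ ψ) := fun h => hp (hψs (tsupport_fderiv_subset ℝ h))
      simp [image_eq_zero_of_notMem_tsupport this]
  have e2 : ∫ p in fluidDomain η, ψ p • g p = ∫ p, ψ p • fderiv ℝ φ p e := by
    refine Eq.trans (integral_congr_ae (hg.mono fun p hp => ?_))
      (setIntegral_eq_integral_of_forall_compl_eq_zero (s := fluidDomain η)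
        (f := fun p => ψ p • fderiv ℝ φ p e) ?_)
    · simp only [hp]
    · intro p hp
      simp [image_eq_zero_of_notMem_tsupport fun h => hp (hψs h)]
  have c1 : Continuous fun p => fderiv ℝ ψ p e :=
    (hψ.continuous_fderiv (by simp)).clm_apply continuous_const
  have c2 := continuous_fderiv_apply_of_contDiff hφ e
  rw [e1, e2, integral_smul_fderiv_eq_neg_fderiv_smul_of_integrable, neg_neg]
  · exact (c1.smul hφ.continuous).integrable_of_hasCompactSupport
      ((hψc.fderiv_apply ℝ e).smul_right)
  · exact (hψ.continuous.smul c2).integrable_of_hasCompactSupport hψc.smul_right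
  · exact (hψ.continuous.smul hφ.continuous).integrable_of_hasCompactSupport hψc.smul_right
  · exact fun p _ => hψ.differentiable (by simp) p
  · exact fun p _ => hφ.differentiable (by simp) p

theorem isWeakDeriv_of_mem_traceGraph {η : ℝ → ℝ} {x : TraceData η} (hx : x ∈ traceGraph η) :
    IsWeakDeriv η (1, 0) x.1 x.2.1 ∧ IsWeakDeriv η (0, 1) x.1 x.2.2.1 := by
  refine traceGraph_induction (P := fun x : TraceData η =>
    IsWeakDeriv η (1, 0) x.1 x.2.1 ∧ IsWeakDeriv η (0, 1) x.1 x.2.2.1) ?_ ?_ hx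
  · exact ((isClosed_isWeakDeriv η (1, 0)).preimage
      (continuous_fst.prodMk (continuous_fst.comp continuous_snd))).inter
      ((isClosed_isWeakDeriv η (0, 1)).preimage
      (continuous_fst.prodMk (continuous_fst.comp (continuous_snd.comp continuous_snd))))
  · rintro x ⟨ψ, hψ, -, h1, h2, h3, -⟩
    exact ⟨isWeakDeriv_of_contDiff hψ h1 h2, isWeakDeriv_of_contDiff hψ h1 h3⟩

/-- The element of `H¹` underlying a point of the graph of the trace operator. -/
def FluidH1.ofTraceGraph {η : ℝ → ℝ} {x : TraceData η} (hx : x ∈ traceGraph η) : FluidH1 η where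
  val := x.1
  dx := x.2.1
  dz := x.2.2.1
  isWeakDeriv_dx := (isWeakDeriv_of_mem_traceGraph hx).1
  isWeakDeriv_dz := (isWeakDeriv_of_mem_traceGraph hx).2

/-! ### The Helmholtz form as an inner product. -/

/-- The Hilbert space in which the energies are computed. -/
abbrev EnergySpace (η : ℝ → ℝ) := PiLp 2 (fun _ : Fin 3 => FluidL2 η)

/-- `(∇φ, kφ)`, whose squared norm is the energy `∫ |∇φ|² + k²|φ|²`. -/
def energyMap (η : ℝ → ℝ) (k : ℝ) : TraceData η →L[ℂ] EnergySpace η :=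
  (PiLp.continuousLinearEquiv 2 ℂ (fun _ : Fin 3 => FluidL2 η)).symm.toContinuousLinearMap ∘L
    ContinuousLinearMap.pi ![
      ContinuousLinearMap.fst ℂ _ _ ∘L ContinuousLinearMap.snd ℂ _ _,
      ContinuousLinearMap.fst ℂ _ _ ∘L ContinuousLinearMap.snd ℂ _ _ ∘L
        ContinuousLinearMap.snd ℂ _ _,
      (k : ℂ) • ContinuousLinearMap.fst ℂ _ _]

theorem inner_energyMap {η : ℝ → ℝ} (k : ℝ) (x y : TraceData η) :
    inner ℂ (energyMap η k x) (energyMap η k y) =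
      inner ℂ x.2.1 y.2.1 + inner ℂ x.2.2.1 y.2.2.1 + (k : ℂ) ^ 2 * inner ℂ x.1 y.1 := by
  simp [-Complex.coe_smul, energyMap, PiLp.inner_apply, Fin.sum_univ_three, inner_smul_left, inner_smul_right]
  ring

theorem norm_energyMap_sq {η : ℝ → ℝ} (k : ℝ) (x : TraceData η) :
    ‖energyMap η k x‖ ^ 2 = ‖x.2.1‖ ^ 2 + ‖x.2.2.1‖ ^ 2 + k ^ 2 * ‖x.1‖ ^ 2 := by
  simp [-Complex.coe_smul, energyMap, PiLp.norm_sq_eq_of_L2, Fin.sum_univ_three, norm_smul, mul_pow]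

/-- The arguments are exchanged because the inner product is antilinear in its first slot.
`energyMap` ignores the surface component, so `u` and `v` may be anything. -/
theorem helmholtzForm_eq_inner {η : ℝ → ℝ} (k : ℝ) (φ w : FluidH1 η)
    (u v : Lp ℂ 2 (volume : Measure ℝ)) :
    helmholtzForm k φ w =
      inner ℂ (energyMap η k (w.val, w.dx, w.dz, v)) (energyMap η k (φ.val, φ.dx, φ.dz, u)) := by
  have i1 := L2.integrable_inner (𝕜 := ℂ) w.dx φ.dx
  have i2 := L2.integrable_inner (𝕜 := ℂ) w.dz φ.dz
  have i3 := (L2.integrable_inner (𝕜 := ℂ) w.val φ.val).const_mul ((k : ℂ) ^ 2)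
  rw [inner_energyMap, L2.inner_def, L2.inner_def, L2.inner_def, ← integral_const_mul]
  exact (integral_add (i1.add i2) i3).trans (congrArg (· + _) (integral_add i1 i2))

/-! ### One-dimensional trace and Poincaré inequalities. -/

/-- Fundamental theorem of calculus for `(t - a)‖f t‖²`. The weight removes the lower endpoint,
where nothing is known. Bounding the cross term from above gives the trace inequality, from below
the Poincaré inequality. -/
theorem sub_mul_norm_sq_eq_integral {f g : ℝ → ℂ} (hf : ∀ t, HasDerivAt f (g t) t)
    (hg : Continuous g) (a b : ℝ) :
    (b - a) * ‖f b‖ ^ 2 = ∫ t in a..b, (‖f t‖ ^ 2 + (t - a) * (2 * inner ℝ (f t) (g t))) := by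
  have hfc : Continuous f := continuous_iff_continuousAt.2 fun t => (hf t).continuousAt
  rw [intervalIntegral.integral_eq_sub_of_hasDerivAt (f := fun t => (t - a) * ‖f t‖ ^ 2)]
  · simp
  · intro t _
    have := ((hasDerivAt_id t).sub_const a).mul (hf t).norm_sq
    simpa using! this
  · exact Continuous.intervalIntegrable (by fun_prop) _ _

/-- Young's inequality with weight `r`, left free for two later uses: `r` equal to the frequency,
and `r → ∞`. -/
theorem norm_sq_endpoint_le {f g : ℝ → ℂ} (hf : ∀ t, HasDerivAt f (g t) t)
    (hg : Continuous g) {a b r : ℝ} (hab : a < b) (hr : 0 < r) :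
    ‖f b‖ ^ 2 ≤ (1 / (b - a) + r) * (∫ t in a..b, ‖f t‖ ^ 2) + r⁻¹ * ∫ t in a..b, ‖g t‖ ^ 2 := by
  have hfc : Continuous f := continuous_iff_continuousAt.2 fun t => (hf t).continuousAt
  have hba : 0 < b - a := sub_pos.2 hab
  have h1 : (b - a) * ‖f b‖ ^ 2 ≤
      ∫ t in a..b, ((1 + (b - a) * r) * ‖f t‖ ^ 2 + (b - a) * r⁻¹ * ‖g t‖ ^ 2) := by
    rw [sub_mul_norm_sq_eq_integral hf hg]
    refine intervalIntegral.integral_mono_on hab.le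
      (Continuous.intervalIntegrable (by fun_prop) _ _)
      (Continuous.intervalIntegrable (by fun_prop) _ _) fun t ht => ?_
    have hi : inner ℝ (f t) (g t) ≤ ‖f t‖ * ‖g t‖ := real_inner_le_norm _ _
    have hs : 2 * (‖f t‖ * ‖g t‖) ≤ r * ‖f t‖ ^ 2 + r⁻¹ * ‖g t‖ ^ 2 := by
      have := mul_nonneg (inv_nonneg.2 hr.le) (sq_nonneg (r * ‖f t‖ - ‖g t‖))
      have e : r⁻¹ * (r * ‖f t‖ - ‖g t‖) ^ 2
        = r * ‖f t‖ ^ 2 + r⁻¹ * ‖g t‖ ^ 2 - 2 * (‖f t‖ * ‖g t‖) := by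
        field_simp
        ring
      linarith
    have h0 : 0 ≤ r * ‖f t‖ ^ 2 + r⁻¹ * ‖g t‖ ^ 2 := by positivity
    have : (t - a) * (2 * inner ℝ (f t) (g t)) ≤ (b - a) * (r * ‖f t‖ ^ 2 + r⁻¹ * ‖g t‖ ^ 2) :=
      (mul_le_mul_of_nonneg_left (by linarith) (sub_nonneg.2 ht.1)).trans
        (mul_le_mul_of_nonneg_right (by linarith [ht.2]) h0)
    linarith
  rw [intervalIntegral.integral_add (Continuous.intervalIntegrable (by fun_prop) _ _)
    (Continuous.intervalIntegrable (by fun_prop) _ _), intervalIntegral.integral_const_mul,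
    intervalIntegral.integral_const_mul] at h1
  refine le_of_mul_le_mul_left (h1.trans_eq ?_) hba
  field_simp

theorem integral_norm_sq_le {f g : ℝ → ℂ} (hf : ∀ t, HasDerivAt f (g t) t)
    (hg : Continuous g) {a b : ℝ} (hab : a ≤ b) :
    (∫ t in a..b, ‖f t‖ ^ 2) ≤
      2 * (b - a) * ‖f b‖ ^ 2 + 4 * (b - a) ^ 2 * ∫ t in a..b, ‖g t‖ ^ 2 := by
  have hfc : Continuous f := continuous_iff_continuousAt.2 fun t => (hf t).continuousAt
  have h1 : (∫ t in a..b, (1 / 2 * ‖f t‖ ^ 2 - 2 * (b - a) ^ 2 * ‖g t‖ ^ 2)) ≤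
      (b - a) * ‖f b‖ ^ 2 := by
    rw [sub_mul_norm_sq_eq_integral hf hg]
    refine intervalIntegral.integral_mono_on hab
      (Continuous.intervalIntegrable (by fun_prop) _ _)
      (Continuous.intervalIntegrable (by fun_prop) _ _) fun t ht => ?_
    have hi : -(‖f t‖ * ‖g t‖) ≤ inner ℝ (f t) (g t) :=
      (abs_le.1 (abs_real_inner_le_norm (f t) (g t))).1
    have h0 : 0 ≤ ‖f t‖ * ‖g t‖ := by positivity
    have h2 : -((b - a) * (‖f t‖ * ‖g t‖)) ≤ (t - a) * inner ℝ (f t) (g t) := by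
      have := mul_le_mul_of_nonneg_left hi (sub_nonneg.2 ht.1)
      have := mul_le_mul_of_nonneg_right (sub_le_sub_right ht.2 a) h0
      linarith
    -- The weights are chosen so that only half of `‖f t‖²` is lost and the rest can be moved to the
    -- other side.
    nlinarith [sq_nonneg (‖f t‖ - 2 * (b - a) * ‖g t‖)]
  rw [intervalIntegral.integral_sub (Continuous.intervalIntegrable (by fun_prop) _ _)
    (Continuous.intervalIntegrable (by fun_prop) _ _), intervalIntegral.integral_const_mul,
    intervalIntegral.integral_const_mul] at h1
  linarith

theorem lintegral_Ioo_enorm_sq {f : ℝ → ℂ} (hf : Continuous f) {a b : ℝ} (hab : a ≤ b) :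
    ∫⁻ t in Set.Ioo a b, ‖f t‖ₑ ^ 2 = ENNReal.ofReal (∫ t in a..b, ‖f t‖ ^ 2) := by
  rw [intervalIntegral.integral_of_le hab, ← restrict_Ioo_eq_restrict_Ioc,
    ofReal_integral_eq_lintegral_ofReal]
  · refine lintegral_congr fun t => ?_
    rw [ENNReal.ofReal_pow (norm_nonneg _), ofReal_norm]
  · exact ((show Continuous fun t => ‖f t‖ ^ 2 by fun_prop).integrableOn_Icc).mono_set
      Set.Ioo_subset_Icc_self
  · exact Eventually.of_forall fun t => by positivity

theorem enorm_sq_endpoint_le {f g : ℝ → ℂ} (hf : ∀ t, HasDerivAt f (g t) t)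
    (hg : Continuous g) {a b r : ℝ} (hab : a < b) (hr : 0 < r) :
    ‖f b‖ₑ ^ 2 ≤ ENNReal.ofReal (1 / (b - a) + r) * (∫⁻ t in Set.Ioo a b, ‖f t‖ₑ ^ 2)
      + ENNReal.ofReal r⁻¹ * ∫⁻ t in Set.Ioo a b, ‖g t‖ₑ ^ 2 := by
  have hfc : Continuous f := continuous_iff_continuousAt.2 fun t => (hf t).continuousAt
  have hba : 0 < b - a := sub_pos.2 hab
  have n1 : 0 ≤ ∫ t in a..b, ‖f t‖ ^ 2 :=
    intervalIntegral.integral_nonneg hab.le fun t _ => by positivity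
  have n2 : 0 ≤ ∫ t in a..b, ‖g t‖ ^ 2 :=
    intervalIntegral.integral_nonneg hab.le fun t _ => by positivity
  rw [lintegral_Ioo_enorm_sq hfc hab.le, lintegral_Ioo_enorm_sq hg hab.le,
    ← ENNReal.ofReal_mul (by positivity), ← ENNReal.ofReal_mul (by positivity),
    ← ENNReal.ofReal_add (by positivity) (by positivity), ← ofReal_norm,
    ← ENNReal.ofReal_pow (norm_nonneg _)]
  exact ENNReal.ofReal_le_ofReal (norm_sq_endpoint_le hf hg hab hr)

theorem lintegral_enorm_sq_le {f g : ℝ → ℂ} (hf : ∀ t, HasDerivAt f (g t) t)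
    (hg : Continuous g) {a b : ℝ} (hab : a ≤ b) :
    ∫⁻ t in Set.Ioo a b, ‖f t‖ₑ ^ 2 ≤ ENNReal.ofReal (2 * (b - a)) * ‖f b‖ₑ ^ 2
      + ENNReal.ofReal (4 * (b - a) ^ 2) * ∫⁻ t in Set.Ioo a b, ‖g t‖ₑ ^ 2 := by
  have hfc : Continuous f := continuous_iff_continuousAt.2 fun t => (hf t).continuousAt
  have hba : 0 ≤ b - a := sub_nonneg.2 hab
  have n2 : 0 ≤ ∫ t in a..b, ‖g t‖ ^ 2 :=
    intervalIntegral.integral_nonneg hab fun t _ => by positivity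
  rw [lintegral_Ioo_enorm_sq hfc hab, lintegral_Ioo_enorm_sq hg hab,
    ← ENNReal.ofReal_mul (by positivity), ← ofReal_norm,
    ← ENNReal.ofReal_pow (norm_nonneg _), ← ENNReal.ofReal_mul (by positivity),
    ← ENNReal.ofReal_add (by positivity) (by positivity)]
  exact ENNReal.ofReal_le_ofReal (integral_norm_sq_le hf hg hab)

/-! ### From vertical slices to the fluid domain. -/

theorem isOpen_fluidDomain {η : ℝ → ℝ} (hη : Continuous η) : IsOpen (fluidDomain η) :=
  (isOpen_lt continuous_const continuous_snd).inter
    (isOpen_lt continuous_snd (hη.comp continuous_fst))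

theorem lintegral_fluidDomain {η : ℝ → ℝ} (hη : Continuous η) {g : ℝ × ℝ → ENNReal}
    (hg : Measurable g) :
    ∫⁻ p in fluidDomain η, g p = ∫⁻ x, ∫⁻ z in Set.Ioo (-1) (η x), g (x, z) := by
  have hm := (isOpen_fluidDomain hη).measurableSet
  rw [← lintegral_indicator hm, Measure.volume_eq_prod, lintegral_prod _
    (hg.indicator hm).aemeasurable]
  refine lintegral_congr fun x => ?_
  rw [← lintegral_indicator measurableSet_Ioo]
  exact lintegral_congr fun z => rfl

theorem measurable_lintegral_slice {η : ℝ → ℝ} (hη : Continuous η) {g : ℝ × ℝ → ENNReal}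
    (hg : Measurable g) : Measurable fun x => ∫⁻ z in Set.Ioo (-1) (η x), g (x, z) := by
  have h := (hg.indicator (isOpen_fluidDomain hη).measurableSet).lintegral_prod_right'
    (ν := (volume : Measure ℝ))
  refine (congrArg Measurable (funext fun x => ?_)).mp h
  rw [← lintegral_indicator measurableSet_Ioo]
  exact lintegral_congr fun z => rfl

theorem enorm_sq_eq_lintegral {α : Type*} [MeasurableSpace α] {μ : Measure α} {f : Lp ℂ 2 μ}
    {g : α → ℂ} (h : f =ᵐ[μ] g) : ‖f‖ₑ ^ 2 = ∫⁻ p, ‖g p‖ₑ ^ 2 ∂μ := by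
  rw [Lp.enorm_def, eLpNorm_congr_ae h, eLpNorm_eq_lintegral_rpow_enorm_toReal (by simp) (by simp),
    ← ENNReal.rpow_natCast, ← ENNReal.rpow_mul]
  simp

theorem enorm_sq_eq_ofReal {E : Type*} [NormedAddCommGroup E] (x : E) :
    ‖x‖ₑ ^ 2 = ENNReal.ofReal (‖x‖ ^ 2) := by
  rw [ENNReal.ofReal_pow (norm_nonneg _), ofReal_norm]

theorem hasDerivAt_slice {ψ : ℝ × ℝ → ℂ} (hψ : ContDiff ℝ ∞ ψ) (x z : ℝ) :
    HasDerivAt (fun t => ψ (x, t)) (fderiv ℝ ψ (x, z) (0, 1)) z :=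
  (hψ.differentiable (by simp) (x, z)).hasFDerivAt.comp_hasDerivAt z
    ((hasDerivAt_const z x).prodMk (hasDerivAt_id z))

theorem poincare_traceGraph {η : ℝ → ℝ} (hη : Continuous η) {L : ℝ}
    (hpos : ∀ x, -1 ≤ η x) (hL : ∀ x, 1 + η x ≤ L) {x : TraceData η} (hx : x ∈ traceGraph η) :
    ‖x.1‖ ^ 2 ≤ 2 * L * ‖x.2.2.2‖ ^ 2 + 4 * L ^ 2 * ‖x.2.2.1‖ ^ 2 := by
  refine traceGraph_induction (P := fun x : TraceData η =>
    ‖x.1‖ ^ 2 ≤ 2 * L * ‖x.2.2.2‖ ^ 2 + 4 * L ^ 2 * ‖x.2.2.1‖ ^ 2) ?_ ?_ hx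
  · exact isClosed_le (by fun_prop) (by fun_prop)
  · rintro x ⟨ψ, hψ, -, h1, -, h3, h4⟩
    have hL0 : 0 ≤ L := by linarith [hpos 0, hL 0]
    have c1 := continuous_fderiv_apply_of_contDiff hψ (0, 1)
    have c0 := hψ.continuous
    have c2 : Continuous fun t => ψ (t, η t) := by fun_prop
    rw [← ENNReal.ofReal_le_ofReal_iff (by positivity),
      ENNReal.ofReal_add (by positivity) (by positivity), ENNReal.ofReal_mul (p := 2 * L)
      (by positivity), ENNReal.ofReal_mul (p := 4 * L ^ 2) (by positivity), ← enorm_sq_eq_ofReal,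
      ← enorm_sq_eq_ofReal, ← enorm_sq_eq_ofReal, enorm_sq_eq_lintegral h1,
      enorm_sq_eq_lintegral h3, enorm_sq_eq_lintegral h4, lintegral_fluidDomain hη (by fun_prop),
      lintegral_fluidDomain hη (by fun_prop), ← lintegral_const_mul' _ _ ENNReal.ofReal_ne_top,
      ← lintegral_const_mul' _ _ ENNReal.ofReal_ne_top, ← lintegral_add_left ((c2.measurable.enorm.pow_const 2).const_mul _)]
    refine lintegral_mono fun t => ?_
    refine (lintegral_enorm_sq_le (hasDerivAt_slice hψ t) (by fun_prop) (hpos t)).trans ?_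
    have := hpos t
    have := hL t
    gcongr <;> linarith

theorem trace_le_traceGraph {η : ℝ → ℝ} (hη : Continuous η) {δ r : ℝ} (hδ : 0 < δ)
    (hpos : ∀ x, δ ≤ 1 + η x) (hr : 0 < r) {x : TraceData η} (hx : x ∈ traceGraph η) :
    ‖x.2.2.2‖ ^ 2 ≤ (1 / δ + r) * ‖x.1‖ ^ 2 + r⁻¹ * ‖x.2.2.1‖ ^ 2 := by
  refine traceGraph_induction (P := fun x : TraceData η =>
    ‖x.2.2.2‖ ^ 2 ≤ (1 / δ + r) * ‖x.1‖ ^ 2 + r⁻¹ * ‖x.2.2.1‖ ^ 2) ?_ ?_ hx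
  · exact isClosed_le (by fun_prop) (by fun_prop)
  · rintro x ⟨ψ, hψ, -, h1, -, h3, h4⟩
    have c1 := continuous_fderiv_apply_of_contDiff hψ (0, 1)
    have c0 := hψ.continuous
    rw [← ENNReal.ofReal_le_ofReal_iff (by positivity),
      ENNReal.ofReal_add (by positivity) (by positivity), ENNReal.ofReal_mul (by positivity),
      ENNReal.ofReal_mul (by positivity), ← enorm_sq_eq_ofReal, ← enorm_sq_eq_ofReal,
      ← enorm_sq_eq_ofReal, enorm_sq_eq_lintegral h1, enorm_sq_eq_lintegral h3,
      enorm_sq_eq_lintegral h4, lintegral_fluidDomain hη (by fun_prop),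
      lintegral_fluidDomain hη (by fun_prop), ← lintegral_const_mul' _ _ (by simp),
      ← lintegral_const_mul' _ _ (by simp),
      ← lintegral_add_left ((measurable_lintegral_slice hη
        (g := fun p => ‖ψ p‖ₑ ^ 2) (by fun_prop)).const_mul _)]
    refine lintegral_mono fun t => ?_
    have := hpos t
    refine (enorm_sq_endpoint_le (hasDerivAt_slice hψ t) (by fun_prop) (a := -1)
      (by linarith) hr).trans ?_
    gcongr
    linarith

/-- When the function vanishes, the trace inequality keeps only the term with factor `r⁻¹`, and `r →
∞` removes it. This is the source of strictness in the monotonicity. -/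
theorem trace_eq_zero_of_val_eq_zero {η : ℝ → ℝ} (hη : Continuous η) {δ : ℝ} (hδ : 0 < δ)
    (hpos : ∀ x, δ ≤ 1 + η x) {x : TraceData η} (hx : x ∈ traceGraph η) (h : x.1 = 0) :
    x.2.2.2 = 0 := by
  have h0 : ‖x.2.2.2‖ ^ 2 ≤ 0 := by
    refine ge_of_tendsto (x := atTop) (f := fun r : ℝ => r⁻¹ * ‖x.2.2.1‖ ^ 2) ?_ ?_
    · simpa using (tendsto_inv_atTop_zero (𝕜 := ℝ)).mul_const (‖x.2.2.1‖ ^ 2)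
    · filter_upwards [eventually_gt_atTop 0] with r hr
      simpa [h] using trace_le_traceGraph hη hδ hpos hr hx
  exact norm_eq_zero.1 (pow_eq_zero_iff (two_ne_zero) |>.1 (le_antisymm h0 (by positivity)))

/-! ### Harmonic extensions and Dirichlet's principle. -/

/-- The elements of the graph of the trace operator with zero trace. -/
def zeroTrace (η : ℝ → ℝ) : Submodule ℂ (TraceData η) where
  carrier := {x | x ∈ traceGraph η ∧ x.2.2.2 = 0}
  add_mem' := fun hx hy => ⟨add_mem hx.1 hy.1, by simp [hx.2, hy.2]⟩
  zero_mem' := ⟨zero_mem _, rfl⟩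
  smul_mem' := fun c x hx => ⟨Submodule.smul_mem _ c hx.1, by simp [hx.2]⟩

/-- The elements of the graph of the trace operator whose energy is stationary under
perturbations of zero trace. -/
def harmonicSpace (η : ℝ → ℝ) (k : ℝ) : Submodule ℂ (TraceData η) where
  carrier := {x | x ∈ traceGraph η ∧
    ∀ w ∈ zeroTrace η, inner ℂ (energyMap η k w) (energyMap η k x) = 0}
  add_mem' := fun hx hy => ⟨add_mem hx.1 hy.1, fun w hw => by
    rw [map_add, inner_add_right, hx.2 w hw, hy.2 w hw, add_zero]⟩
  zero_mem' := ⟨zero_mem _, fun w _ => by simp⟩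
  smul_mem' := fun c x hx => ⟨Submodule.smul_mem _ c hx.1, fun w hw => by
    rw [map_smul, inner_smul_right, hx.2 w hw, mul_zero]⟩

/-- A Poincaré inequality on the graph of the trace operator. -/
def PoincareInequality (η : ℝ → ℝ) (a b : ℝ) : Prop :=
  ∀ x ∈ traceGraph η, ‖x.1‖ ≤ a * ‖x.2.2.2‖ + b * ‖x.2.2.1‖

section Hilbert

variable {η : ℝ → ℝ} {a b : ℝ}

theorem norm_dx_le_energyMap (k : ℝ) (x : TraceData η) : ‖x.2.1‖ ≤ ‖energyMap η k x‖ :=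
  le_of_sq_le_sq (by
    rw [norm_energyMap_sq]
    have h1 := sq_nonneg ‖x.2.2.1‖
    have h2 := mul_nonneg (sq_nonneg k) (sq_nonneg ‖x.1‖)
    linarith) (norm_nonneg _)

theorem norm_dz_le_energyMap (k : ℝ) (x : TraceData η) : ‖x.2.2.1‖ ≤ ‖energyMap η k x‖ :=
  le_of_sq_le_sq (by
    rw [norm_energyMap_sq]
    have h1 := sq_nonneg ‖x.2.1‖
    have h2 := mul_nonneg (sq_nonneg k) (sq_nonneg ‖x.1‖)
    linarith) (norm_nonneg _)

/-- Even for `k = 0`, where the energy sees only the gradient, trace and energy together control the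
full norm. -/
theorem PoincareInequality.norm_le (hP : PoincareInequality η a b) (ha : 0 ≤ a) (hb : 0 ≤ b)
    (k : ℝ) {x : TraceData η} (hx : x ∈ traceGraph η) :
    ‖x‖ ≤ (1 + a + b) * (‖x.2.2.2‖ + ‖energyMap η k x‖) := by
  have h1 := hP x hx
  have h2 := norm_dx_le_energyMap k x
  have h3 := norm_dz_le_energyMap k x
  have n0 := norm_nonneg x.2.2.2
  have n1 := norm_nonneg (energyMap η k x)
  have e1 := mul_nonneg ha n0
  have e2 := mul_nonneg ha n1
  have e3 := mul_nonneg hb n0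
  have e4 := mul_nonneg hb n1
  have e5 := mul_le_mul_of_nonneg_left h3 hb
  simp only [Prod.norm_def, sup_le_iff]
  refine ⟨?_, ?_, ?_, ?_⟩ <;> linarith

/-- The solution is any extension minus the zero-trace function whose energy vector is the
projection of the energy vector of that extension. -/
theorem PoincareInequality.exists_harmonic (hP : PoincareInequality η a b) (ha : 0 ≤ a)
    (hb : 0 ≤ b) (k : ℝ) {x : TraceData η} (hx : x ∈ traceGraph η) :
    ∃ y ∈ harmonicSpace η k, y.2.2.2 = x.2.2.2 := by
  have hcl : IsClosed (zeroTrace η : Set (TraceData η)) :=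
    (isClosed_traceGraph η).inter (isClosed_eq (by fun_prop) continuous_const)
  have : CompleteSpace (zeroTrace η) := hcl.completeSpace_coe
  let f : zeroTrace η →L[ℂ] EnergySpace η := energyMap η k ∘L (zeroTrace η).subtypeL
  -- On zero traces the energy dominates the norm, so the image of the energy map is complete and
  -- the projection onto it exists.
  have hf : AntilipschitzWith (1 + a + b).toNNReal f := by
    refine AddMonoidHomClass.antilipschitz_of_bound f fun w => ?_
    rw [Real.coe_toNNReal _ (by positivity)]
    have := hP.norm_le ha hb k w.2.1
    rwa [w.2.2, norm_zero, zero_add] at this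
  have hc : IsComplete (f.range : Set (EnergySpace η)) :=
    hf.isComplete_range f.uniformContinuous
  have : CompleteSpace f.range := hc.completeSpace_coe
  obtain ⟨w, hw⟩ := (f.range.starProjection_apply_mem (energyMap η k x) :)
  refine ⟨x - w, ⟨sub_mem hx w.2.1, fun v hv => ?_⟩, ?_⟩
  · have h := Submodule.sub_starProjection_mem_orthogonal (K := f.range) (energyMap η k x)
    rw [← hw] at h
    rw [map_sub]
    exact h _ ⟨⟨v, hv⟩, rfl⟩
  · have := w.2.2
    simp [this]

theorem inner_energyMap_eq_of_trace_eq {k : ℝ} {y : TraceData η} (hy : y ∈ harmonicSpace η k)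
    {v w : TraceData η} (hv : v ∈ traceGraph η) (hw : w ∈ traceGraph η)
    (h : v.2.2.2 = w.2.2.2) :
    inner ℂ (energyMap η k v) (energyMap η k y) = inner ℂ (energyMap η k w) (energyMap η k y) := by
  have := hy.2 (v - w) ⟨sub_mem hv hw, by simp [h]⟩
  rwa [map_sub, inner_sub_left, sub_eq_zero] at this

/-- Dirichlet's principle: `z - y` has zero trace, so `⟨z, y⟩ = ‖y‖²` in energy, and Cauchy-Schwarz
concludes. -/
theorem norm_energyMap_le_of_trace_eq {k : ℝ} {y : TraceData η} (hy : y ∈ harmonicSpace η k)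
    {z : TraceData η} (hz : z ∈ traceGraph η) (h : z.2.2.2 = y.2.2.2) :
    ‖energyMap η k y‖ ≤ ‖energyMap η k z‖ := by
  have h1 := inner_energyMap_eq_of_trace_eq hy hz hy.1 h
  have h2 : ‖energyMap η k y‖ * ‖energyMap η k y‖ ≤ ‖energyMap η k z‖ * ‖energyMap η k y‖ := by
    have := norm_inner_le_norm (𝕜 := ℂ) (energyMap η k z) (energyMap η k y)
    rw [h1, inner_self_eq_norm_sq_to_K, norm_pow, RCLike.norm_ofReal, abs_norm, sq] at this
    exact this
  rcases (norm_nonneg (energyMap η k y)).eq_or_lt with h0 | h0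
  · rw [← h0]
    exact norm_nonneg _
  · exact le_of_mul_le_mul_right h2 h0

theorem PoincareInequality.harmonic_unique (hP : PoincareInequality η a b) (ha : 0 ≤ a)
    (hb : 0 ≤ b) {k : ℝ} {x y : TraceData η} (hx : x ∈ harmonicSpace η k)
    (hy : y ∈ harmonicSpace η k) (h : x.2.2.2 = y.2.2.2) : x = y := by
  have hd := sub_mem hx hy
  have h0 : (x - y).2.2.2 = 0 := by simp [h]
  have h1 := hP.norm_le ha hb k hd.1
  have h2 := inner_self_eq_zero.1 (hd.2 _ ⟨hd.1, h0⟩)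
  rw [h0, h2, norm_zero, norm_zero, add_zero, mul_zero] at h1
  exact sub_eq_zero.1 (norm_le_zero_iff.1 h1)

/-- The given extensions need not depend linearly on `g`, so their differences are not controlled.
Harmonic ones do and have no greater energy; along a sequence in `S` converging to `g` they are
therefore Cauchy. The norms of `T` and `M` serve only for this convergence, and the final constant
remains `B`. -/
theorem PoincareInequality.exists_extension_of_dense (hP : PoincareInequality η a b) (ha : 0 ≤ a)
    (hb : 0 ≤ b) {k B : ℝ} (hB : 0 ≤ B) {F : Type*} [NormedAddCommGroup F] [NormedSpace ℂ F]
    (T : F →L[ℂ] Lp ℂ 2 (volume : Measure ℝ)) (M : F →L[ℂ] F) {S : Submodule ℂ F}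
    (hS : Dense (S : Set F))
    (h : ∀ g ∈ S, ∃ z ∈ traceGraph η, z.2.2.2 = T g ∧ ‖energyMap η k z‖ ≤ B * ‖M g‖) (g : F) :
    ∃ z ∈ traceGraph η, z.2.2.2 = T g ∧ ‖energyMap η k z‖ ≤ B * ‖M g‖ := by
  have hh : ∀ g ∈ S, ∃ z ∈ harmonicSpace η k, z.2.2.2 = T g := fun g hg => by
    obtain ⟨z, hz, e, -⟩ := h g hg
    obtain ⟨y, hy, e'⟩ := hP.exists_harmonic ha hb k hz
    exact ⟨y, hy, e'.trans e⟩
  have hle : ∀ g ∈ S, ∀ y ∈ harmonicSpace η k, y.2.2.2 = T g → ‖energyMap η k y‖ ≤ B * ‖M g‖ :=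
    fun g hg y hy e => by
      obtain ⟨z, hz, e', hz'⟩ := h g hg
      exact (norm_energyMap_le_of_trace_eq hy hz (e'.trans e.symm)).trans hz'
  obtain ⟨s, hsS, hs⟩ := mem_closure_iff_seq_limit.1 (hS g)
  choose y hy hyT using fun n => hh (s n) (hsS n)
  set K := (1 + a + b) * (‖T‖ + B * ‖M‖) with hK
  have hK0 : 0 ≤ K := by positivity
  have hdist : ∀ m n, dist (y m) (y n) ≤ K * dist (s m) (s n) := fun m n => by
    have hd := sub_mem (hy m) (hy n)
    have hT : (y m - y n).2.2.2 = T (s m - s n) := by simp [hyT]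
    have h1 := hP.norm_le ha hb k hd.1
    have h2 := hle _ (sub_mem (hsS m) (hsS n)) _ hd hT
    rw [hT] at h1
    rw [dist_eq_norm, dist_eq_norm]
    refine h1.trans ?_
    rw [hK, mul_assoc]
    refine mul_le_mul_of_nonneg_left ?_ (by positivity)
    have h3 := T.le_opNorm (s m - s n)
    have h4 := mul_le_mul_of_nonneg_left (M.le_opNorm (s m - s n)) hB
    linarith
  have hcau : CauchySeq y := by
    have hsc := hs.cauchySeq
    rw [Metric.cauchySeq_iff] at hsc ⊢
    intro ε hε
    obtain ⟨N, hN⟩ := hsc (ε / (K + 1)) (by positivity)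
    refine ⟨N, fun m hm n hn => (hdist m n).trans_lt ?_⟩
    have := hN m hm n hn
    rw [lt_div_iff₀ (by positivity)] at this
    nlinarith [dist_nonneg (x := s m) (y := s n)]
  obtain ⟨z, hz⟩ := cauchySeq_tendsto_of_complete hcau
  refine ⟨z, (isClosed_traceGraph η).mem_of_tendsto hz (Eventually.of_forall fun n => (hy n).1),
    ?_, ?_⟩
  · refine tendsto_nhds_unique ((show Continuous fun z : TraceData η => z.2.2.2 by
      fun_prop).tendsto z |>.comp hz) ?_
    exact ((T.continuous.tendsto g).comp hs).congr fun n => (hyT n).symm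
  · refine le_of_tendsto_of_tendsto' (((energyMap η k).continuous.norm.tendsto z).comp hz)
      (((M.continuous.norm.const_mul B).tendsto g).comp hs) fun n => ?_
    exact hle _ (hsS n) _ (hy n) (hyT n)

theorem isDirichletSolution_iff (hη : Continuous η) {k : ℝ} {u : Hhalf} {φ : FluidH1 η} :
    IsDirichletSolution η k u φ ↔
      (φ.val, φ.dx, φ.dz, (u : Lp ℂ 2 (volume : Measure ℝ))) ∈ harmonicSpace η k := by
  simp only [IsDirichletSolution, hasSurfaceTrace_iff hη]
  refine and_congr_right fun _ => ⟨fun h w hw => ?_, fun h w hw => ?_⟩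
  · have h1 : ((FluidH1.ofTraceGraph hw.1).val, (FluidH1.ofTraceGraph hw.1).dx,
        (FluidH1.ofTraceGraph hw.1).dz, (0 : Lp ℂ 2 (volume : Measure ℝ))) = w :=
      Prod.ext rfl (Prod.ext rfl (Prod.ext rfl hw.2.symm))
    have h2 := h (FluidH1.ofTraceGraph hw.1) (by rw [h1]; exact hw.1)
    rwa [helmholtzForm_eq_inner k _ _ (u : Lp ℂ 2 (volume : Measure ℝ)) 0, h1] at h2
  · rw [helmholtzForm_eq_inner k _ _ (u : Lp ℂ 2 (volume : Measure ℝ)) 0]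
    exact h _ ⟨hw, rfl⟩

theorem isDirichletSolution_ofTraceGraph (hη : Continuous η) {k : ℝ} {u : Hhalf}
    {y : TraceData η} (hy : y ∈ harmonicSpace η k) (hu : y.2.2.2 = u) :
    IsDirichletSolution η k u (FluidH1.ofTraceGraph hy.1) := by
  rw [isDirichletSolution_iff hη, ← hu]
  exact hy

/-- Every element of `H^{1/2}` has an extension to the fluid domain. -/
def HasExtensions (η : ℝ → ℝ) : Prop :=
  ∀ u : Hhalf, ∃ x ∈ traceGraph η, x.2.2.2 = u

theorem PoincareInequality.existsUnique_isDirichletSolution (hP : PoincareInequality η a b)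
    (ha : 0 ≤ a) (hb : 0 ≤ b) (hη : Continuous η) (hE : HasExtensions η) (k : ℝ) (u : Hhalf) :
    ∃! φ : FluidH1 η, IsDirichletSolution η k u φ := by
  obtain ⟨x, hx, hxu⟩ := hE u
  obtain ⟨y, hy, hyx⟩ := hP.exists_harmonic ha hb k hx
  refine ⟨_, isDirichletSolution_ofTraceGraph hη hy (hyx.trans hxu), fun φ hφ => ?_⟩
  have h := hP.harmonic_unique ha hb ((isDirichletSolution_iff hη).1 hφ) hy (hyx.trans hxu).symm
  exact FluidH1.ext (congrArg Prod.fst h) (congrArg (fun x => x.2.1) h)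
    (congrArg (fun x => x.2.2.1) h)

theorem PoincareInequality.exists_isDirichletNeumann (hP : PoincareInequality η a b)
    (ha : 0 ≤ a) (hb : 0 ≤ b) (hη : Continuous η) (hE : HasExtensions η) (k : ℝ) :
    ∃ G, IsDirichletNeumann η k G := by
  have hex : ∀ u : Hhalf, ∃ y ∈ harmonicSpace η k, y.2.2.2 = u := fun u => by
    obtain ⟨x, hx, hxu⟩ := hE u
    obtain ⟨y, hy, hyx⟩ := hP.exists_harmonic ha hb k hx
    exact ⟨y, hy, hyx.trans hxu⟩
  choose y hy hyu using hex
  have hadd : ∀ u v, y (u + v) = y u + y v := fun u v =>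
    hP.harmonic_unique ha hb (hy _) (add_mem (hy u) (hy v)) (by simp [hyu])
  have hsmul : ∀ (c : ℂ) u, y (c • u) = c • y u := fun c u =>
    hP.harmonic_unique ha hb (hy _) (Submodule.smul_mem _ c (hy u)) (by simp [hyu])
  refine ⟨LinearMap.mk₂'ₛₗ (RingHom.id ℂ) (starRingEnd ℂ)
    (fun u v => inner ℂ (energyMap η k (y v)) (energyMap η k (y u))) ?_ ?_ ?_ ?_, ?_⟩
  · intro u u' v
    rw [hadd, map_add, inner_add_right]
  · intro c u v
    rw [hsmul, map_smul, inner_smul_right]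
    rfl
  · intro u v v'
    rw [hadd, map_add, inner_add_left]
  · intro c u v
    rw [hsmul, map_smul, inner_smul_left]
    rfl
  · intro u φ hφ v w hw
    rw [hasSurfaceTrace_iff hη] at hw
    rw [isDirichletSolution_iff hη] at hφ
    have e := helmholtzForm_eq_inner k φ w (u : Lp ℂ 2 (volume : Measure ℝ))
      (v : Lp ℂ 2 (volume : Measure ℝ))
    rw [hP.harmonic_unique ha hb hφ (hy u) (hyu u).symm] at e
    exact (inner_energyMap_eq_of_trace_eq (hy u) (hy v).1 hw (hyu v)).trans e.symm

/-- Any extension of `v` may be used. The harmonic one gives symmetry, and the formula leaves no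
freedom for `G`. -/
theorem IsDirichletNeumann.apply_eq_inner {k : ℝ} {G : Hhalf →ₗ[ℂ] Hhalf →ₗ⋆[ℂ] ℂ}
    (hG : IsDirichletNeumann η k G) (hη : Continuous η) {u v : Hhalf} {x y : TraceData η}
    (hy : y ∈ harmonicSpace η k) (hyu : y.2.2.2 = u) (hx : x ∈ traceGraph η)
    (hxv : x.2.2.2 = v) :
    G u v = inner ℂ (energyMap η k x) (energyMap η k y) := by
  rw [hG u _ (isDirichletSolution_ofTraceGraph hη hy hyu) v (FluidH1.ofTraceGraph hx)
    ((hasSurfaceTrace_iff hη _ _).2 (by rw [← hxv]; exact hx)),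
    helmholtzForm_eq_inner k _ _ y.2.2.2 x.2.2.2]
  rfl

end Hilbert

/-! ### Reduction of the theorem to two energy estimates. -/

/-- Minimality explains the asymmetry of `hlow`, required of every extension, and `hup`, required of
one. -/
theorem dirichletNeumann_properties_of_bounds {η : ℝ → ℝ} {a b : ℝ}
    (hP : PoincareInequality η a b) (ha : 0 ≤ a) (hb : 0 ≤ b) (hη : Continuous η)
    (hT : ∀ x ∈ traceGraph η, x.1 = 0 → x.2.2.2 = 0) {c C : ℝ} (hc : 0 < c) (hC : 0 < C)
    (hlow : ∀ (k : ℝ) (u : Hhalf), ∀ x ∈ traceGraph η, x.2.2.2 = u →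
      c * dnNorm k u ^ 2 ≤ ‖energyMap η k x‖ ^ 2)
    (hup : ∀ (k : ℝ) (u : Hhalf), ∃ x ∈ traceGraph η, x.2.2.2 = u ∧
      ‖energyMap η k x‖ ≤ C * dnNorm k u) :
    (∀ (k : ℝ) (u : Hhalf), ∃! φ : FluidH1 η, IsDirichletSolution η k u φ) ∧
    (∀ k : ℝ, IsDirichletNeumann η k (dirichletNeumann η k) ∧
      ∀ G, IsDirichletNeumann η k G → G = dirichletNeumann η k) ∧
    (∀ (k : ℝ) (u v : Hhalf),
      dirichletNeumann η k u v = conj (dirichletNeumann η k v u)) ∧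
    (∀ k₁ k₂ : ℝ, |k₂| < |k₁| → ∀ u : Hhalf, u ≠ 0 →
      (dirichletNeumann η k₂ u u).re < (dirichletNeumann η k₁ u u).re) ∧
    (∃ c C : ℝ, 0 < c ∧ 0 < C ∧ ∀ k : ℝ,
      (∀ u v : Hhalf, ‖dirichletNeumann η k u v‖ ≤ C * dnNorm k u * dnNorm k v) ∧
      (∀ u : Hhalf, c * dnNorm k u ^ 2 ≤ (dirichletNeumann η k u u).re)) := by
  have hE : HasExtensions η := fun u => by
    obtain ⟨x, hx, hxu, -⟩ := hup 0 u
    exact ⟨x, hx, hxu⟩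
  have hG : ∀ k, IsDirichletNeumann η k (dirichletNeumann η k) := fun k =>
    Classical.epsilon_spec (hP.exists_isDirichletNeumann ha hb hη hE k)
  have hH : ∀ (k : ℝ) (u : Hhalf), ∃ y ∈ harmonicSpace η k, y.2.2.2 = u := fun k u => by
    obtain ⟨x, hx, hxu⟩ := hE u
    obtain ⟨y, hy, hyx⟩ := hP.exists_harmonic ha hb k hx
    exact ⟨y, hy, hyx.trans hxu⟩
  choose y hy hyu using hH
  have hre : ∀ k u, (dirichletNeumann η k u u).re = ‖energyMap η k (y k u)‖ ^ 2 := fun k u => by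
    rw [(hG k).apply_eq_inner hη (hy k u) (hyu k u) (hy k u).1 (hyu k u)]
    exact inner_self_eq_norm_sq (𝕜 := ℂ) (energyMap η k (y k u))
  refine ⟨hP.existsUnique_isDirichletSolution ha hb hη hE, fun k => ⟨hG k, fun G hG' => ?_⟩,
    fun k u v => ?_, fun k₁ k₂ hk u hu => ?_, c, C ^ 2, hc, by positivity, fun k =>
    ⟨fun u v => ?_, fun u => ?_⟩⟩
  · ext u v
    rw [hG'.apply_eq_inner hη (hy k u) (hyu k u) (hy k v).1 (hyu k v),
      (hG k).apply_eq_inner hη (hy k u) (hyu k u) (hy k v).1 (hyu k v)]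
  · rw [(hG k).apply_eq_inner hη (hy k u) (hyu k u) (hy k v).1 (hyu k v),
      (hG k).apply_eq_inner hη (hy k v) (hyu k v) (hy k u).1 (hyu k u), inner_conj_symm]
  · rw [hre, hre]
    -- The `k₁`-solution is a competitor for `k₂`. Its own energy drops strictly from `k₁` to `k₂`,
    -- since `hT` and `u ≠ 0` prevent its `L²` norm from vanishing.
    have h1 : ‖energyMap η k₂ (y k₂ u)‖ ≤ ‖energyMap η k₂ (y k₁ u)‖ :=
      norm_energyMap_le_of_trace_eq (hy k₂ u) (hy k₁ u).1 ((hyu k₁ u).trans (hyu k₂ u).symm)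
    refine (pow_le_pow_left₀ (norm_nonneg _) h1 2).trans_lt ?_
    rw [norm_energyMap_sq, norm_energyMap_sq]
    have h0 : (y k₁ u).1 ≠ 0 := fun h => hu (by
      have := hT _ (hy k₁ u).1 h
      rw [hyu] at this
      exact_mod_cast this)
    have h2 : k₂ ^ 2 < k₁ ^ 2 := sq_lt_sq.2 hk
    have h3 : 0 < ‖(y k₁ u).1‖ ^ 2 := by positivity
    nlinarith
  · have hle : ∀ u, ‖energyMap η k (y k u)‖ ≤ C * dnNorm k u := fun u => by
      obtain ⟨x, hx, hxu, hxC⟩ := hup k u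
      exact (norm_energyMap_le_of_trace_eq (hy k u) hx (hxu.trans (hyu k u).symm)).trans hxC
    rw [(hG k).apply_eq_inner hη (hy k u) (hyu k u) (hy k v).1 (hyu k v)]
    refine (norm_inner_le_norm _ _).trans ?_
    calc _ ≤ (C * dnNorm k v) * (C * dnNorm k u) :=
          mul_le_mul (hle v) (hle u) (norm_nonneg _) ((norm_nonneg _).trans (hle v))
      _ = _ := by ring
  · rw [hre]
    exact hlow k u _ (hy k u).1 (hyu k u)

/-! ### Integrals depending on a parameter. -/

theorem continuous_integral_of_compact {X : Type*} [TopologicalSpace X]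
    [FirstCountableTopology X] [LocallyCompactSpace X] {f : X → ℝ → ℂ}
    (hf : Continuous (Function.uncurry f)) {K : Set ℝ} (hK : IsCompact K)
    (h : ∀ x, ∀ y ∉ K, f x y = 0) : Continuous fun x => ∫ y, f x y := by
  refine (continuous_parametric_integral_of_continuous (μ := volume) hf hK).congr fun x => ?_
  exact setIntegral_eq_integral_of_forall_compl_eq_zero (h x)

theorem hasDerivAt_integral_of_compact {f f' : ℝ → ℝ → ℂ}
    (hf : Continuous (Function.uncurry f)) (hf' : Continuous (Function.uncurry f'))
    (hd : ∀ s y, HasDerivAt (fun s => f s y) (f' s y) s) {K : Set ℝ} (hK : IsCompact K)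
    (h : ∀ s, ∀ y ∉ K, f s y = 0) (h' : ∀ s, ∀ y ∉ K, f' s y = 0) (s : ℝ) :
    HasDerivAt (fun s => ∫ y, f s y) (∫ y, f' s y) s := by
  have c1 : ∀ s, Continuous (f s) := fun s => hf.comp (Continuous.prodMk_right s)
  have c2 : ∀ s, Continuous (f' s) := fun s => hf'.comp (Continuous.prodMk_right s)
  obtain ⟨B, hB⟩ := ((isCompact_Icc (a := s - 1) (b := s + 1)).prod hK).exists_bound_of_continuousOn
    hf'.continuousOn
  refine (hasDerivAt_integral_of_dominated_loc_of_deriv_le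
    (bound := K.indicator fun _ => B) (s := Set.Icc (s - 1) (s + 1))
    (Icc_mem_nhds (by linarith) (by linarith))
    (Eventually.of_forall fun t => (c1 t).aestronglyMeasurable)
    ((c1 s).integrable_of_hasCompactSupport (HasCompactSupport.intro hK (h s)))
    (c2 s).aestronglyMeasurable (Eventually.of_forall fun y t ht => ?_) ?_
    (Eventually.of_forall fun y t _ => hd t y)).2
  · by_cases hy : y ∈ K
    · rw [Set.indicator_of_mem hy]
      exact hB (t, y) ⟨ht, hy⟩
    · rw [Set.indicator_of_notMem hy, h' t y hy, norm_zero]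
  · exact (integrable_indicator_iff hK.measurableSet).2 (integrableOn_const hK.measure_ne_top)

/-! ### Lower estimate on a flat strip. -/

/-- The symbol `√(ξ² + k²)`, with the frequency in the normalization of `𝓕`. -/
def freq (k ξ : ℝ) : ℝ := √((2 * Real.pi * ξ) ^ 2 + k ^ 2)

theorem freq_nonneg (k ξ : ℝ) : 0 ≤ freq k ξ := Real.sqrt_nonneg _

theorem freq_sq (k ξ : ℝ) : freq k ξ ^ 2 = (2 * Real.pi * ξ) ^ 2 + k ^ 2 :=
  Real.sq_sqrt (by positivity)

/-- The symbol whose `L²` norm against the Fourier transform is `dnNorm`. -/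
def dnMultiplier (k ξ : ℝ) : ℝ := freq k ξ / √(1 + freq k ξ)

theorem dnMultiplier_nonneg (k ξ : ℝ) : 0 ≤ dnMultiplier k ξ :=
  div_nonneg (freq_nonneg _ _) (Real.sqrt_nonneg _)

theorem dnMultiplier_sq (k ξ : ℝ) : dnMultiplier k ξ ^ 2 = freq k ξ ^ 2 / (1 + freq k ξ) := by
  rw [dnMultiplier, div_pow, Real.sq_sqrt (by linarith [freq_nonneg k ξ])]

theorem continuous_freq (k : ℝ) : Continuous (freq k) := by
  unfold freq
  fun_prop

theorem continuous_dnMultiplier (k : ℝ) : Continuous (dnMultiplier k) := by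
  have := continuous_freq k
  exact this.div (by fun_prop) fun ξ => by
    have := freq_nonneg k ξ
    positivity

/-- The square of `dnNorm` as an extended nonnegative number, for an arbitrary function
on the Fourier side. -/
def dnEnergy (k : ℝ) (f : ℝ → ℂ) : ENNReal := ∫⁻ ξ, ‖(dnMultiplier k ξ : ℂ) * f ξ‖ₑ ^ 2

theorem dnNorm_sq (k : ℝ) (u : Hhalf) :
    dnNorm k u ^ 2 = (dnEnergy k
      (𝓕 (u : Lp ℂ 2 (volume : Measure ℝ)) : Lp ℂ 2 (volume : Measure ℝ))).toReal := by
  rw [dnNorm, ← ENNReal.toReal_pow, eLpNorm_eq_lintegral_rpow_enorm_toReal (by simp) (by simp),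
    ← ENNReal.rpow_natCast, ← ENNReal.rpow_mul]
  simp [dnEnergy, dnMultiplier, freq]

theorem lintegral_enorm_sq_fourier {g : ℝ → ℂ} (hg : ContDiff ℝ ∞ g) (hc : HasCompactSupport g) :
    ∫⁻ ξ, ‖𝓕 g ξ‖ₑ ^ 2 = ∫⁻ x, ‖g x‖ₑ ^ 2 := by
  let f := hc.toSchwartzMap hg
  have hf : (f : ℝ → ℂ) = g := rfl
  have h := congrArg ENNReal.ofReal
    (congrArg (· ^ 2) (SchwartzMap.norm_fourier_toL2_eq f))
  simp only [← enorm_sq_eq_ofReal] at h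
  rwa [enorm_sq_eq_lintegral (SchwartzMap.coeFn_toLp _ 2 volume),
    enorm_sq_eq_lintegral (SchwartzMap.coeFn_toLp _ 2 volume), SchwartzMap.fourier_coe, hf] at h

theorem fourier_ae_eq_of_ae_eq {u : Lp ℂ 2 (volume : Measure ℝ)} {g : ℝ → ℂ}
    (hg : ContDiff ℝ ∞ g) (hc : HasCompactSupport g) (h : u =ᵐ[volume] g) :
    (𝓕 u : Lp ℂ 2 (volume : Measure ℝ)) =ᵐ[volume] 𝓕 g := by
  let f := hc.toSchwartzMap hg
  have hf : (f : ℝ → ℂ) = g := rfl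
  have e : u = f.toLp 2 := Lp.ext (h.trans (SchwartzMap.coeFn_toLp f 2 volume).symm)
  rw [e, SchwartzMap.toLp_fourier_eq]
  exact (SchwartzMap.coeFn_toLp _ 2 volume).trans (by rw [SchwartzMap.fourier_coe, hf])

section Strip

variable {Φ : ℝ × ℝ → ℂ}

theorem HasCompactSupport.exists_compact_fst {E : Type*} [Zero E] {Φ : ℝ × ℝ → E}
    (hc : HasCompactSupport Φ) : ∃ K : Set ℝ, IsCompact K ∧ ∀ s, ∀ x ∉ K, Φ (x, s) = 0 := by
  refine ⟨_, hc.isCompact.image continuous_fst, fun s x hx => ?_⟩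
  by_contra h
  exact hx ⟨(x, s), subset_tsupport _ h, rfl⟩

theorem continuous_fourier_slice (hΦ : Continuous Φ) (hc : HasCompactSupport Φ) :
    Continuous fun p : ℝ × ℝ => 𝓕 (fun x => Φ (x, p.2)) p.1 := by
  obtain ⟨K, hK, h⟩ := hc.exists_compact_fst
  simp only [Real.fourier_real_eq_integral_exp_smul]
  refine continuous_integral_of_compact ?_ hK fun p x hx => by simp [h p.2 x hx]
  simp only [Function.uncurry_def]
  fun_prop

theorem continuous_fourier_slice_left (hΦ : Continuous Φ) (hc : HasCompactSupport Φ) (s : ℝ) :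
    Continuous (𝓕 fun x => Φ (x, s)) :=
  show Continuous ((fun p : ℝ × ℝ => 𝓕 (fun x => Φ (x, p.2)) p.1) ∘ fun ξ => (ξ, s)) from
    (continuous_fourier_slice hΦ hc).comp (by fun_prop)

theorem continuous_fourier_slice_right (hΦ : Continuous Φ) (hc : HasCompactSupport Φ) (ξ : ℝ) :
    Continuous fun s => 𝓕 (fun x => Φ (x, s)) ξ :=
  show Continuous ((fun p : ℝ × ℝ => 𝓕 (fun x => Φ (x, p.2)) p.1) ∘ fun s => (ξ, s)) from
    (continuous_fourier_slice hΦ hc).comp (by fun_prop)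

theorem hasDerivAt_fourier_slice (hΦ : ContDiff ℝ ∞ Φ) (hc : HasCompactSupport Φ) (ξ s : ℝ) :
    HasDerivAt (fun s => 𝓕 (fun x => Φ (x, s)) ξ)
      (𝓕 (fun x => fderiv ℝ Φ (x, s) (0, 1)) ξ) s := by
  obtain ⟨K, hK, h⟩ := hc.exists_compact_fst
  obtain ⟨K', hK', h'⟩ := (hc.fderiv_apply ℝ (0, 1)).exists_compact_fst
  have c0 := hΦ.continuous
  have c1 := continuous_fderiv_apply_of_contDiff hΦ (0, 1)
  simp only [Real.fourier_real_eq_integral_exp_smul]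
  refine hasDerivAt_integral_of_compact
    (f := fun s x => Complex.exp (↑(-2 * Real.pi * x * ξ) * Complex.I) • Φ (x, s))
    (f' := fun s x => Complex.exp (↑(-2 * Real.pi * x * ξ) * Complex.I) •
      fderiv ℝ Φ (x, s) (0, 1)) ?_ ?_ (fun s x => ?_) (hK.union hK')
    (fun s x hx => by simp [h s x fun hx' => hx (Or.inl hx')])
    (fun s x hx => by simp [h' s x fun hx' => hx (Or.inr hx')]) s
  · simp only [Function.uncurry_def]
    fun_prop
  · simp only [Function.uncurry_def]
    exact (show Continuous fun p : ℝ × ℝ => Complex.exp (↑(-2 * Real.pi * p.2 * ξ) * Complex.I)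
      by fun_prop).smul (c1.comp (show Continuous fun p : ℝ × ℝ => (p.2, p.1) by fun_prop))
  · exact (hasDerivAt_slice hΦ x s).const_smul (Complex.exp (↑(-2 * Real.pi * x * ξ) * Complex.I))

theorem contDiff_slice (hΦ : ContDiff ℝ ∞ Φ) (s : ℝ) : ContDiff ℝ ∞ fun x => Φ (x, s) :=
  hΦ.comp (contDiff_id.prodMk contDiff_const)

theorem HasCompactSupport.slice {E : Type*} [Zero E] {Φ : ℝ × ℝ → E} (hc : HasCompactSupport Φ)
    (s : ℝ) : HasCompactSupport fun x => Φ (x, s) := by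
  obtain ⟨K, hK, h⟩ := hc.exists_compact_fst
  exact HasCompactSupport.intro hK (h s)

theorem contDiff_fderiv_apply (hΦ : ContDiff ℝ ∞ Φ) (e : ℝ × ℝ) :
    ContDiff ℝ ∞ fun p => fderiv ℝ Φ p e :=
  (hΦ.fderiv_right (m := ∞) (by simp)).clm_apply contDiff_const

theorem fourier_slice_dx (hΦ : ContDiff ℝ ∞ Φ) (hc : HasCompactSupport Φ) (ξ s : ℝ) :
    𝓕 (fun x => fderiv ℝ Φ (x, s) (1, 0)) ξ
      = (2 * Real.pi * Complex.I * ξ) * 𝓕 (fun x => Φ (x, s)) ξ := by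
  have hd : deriv (fun x => Φ (x, s)) = fun x => fderiv ℝ Φ (x, s) (1, 0) := by
    ext x
    exact ((hΦ.differentiable (by simp) (x, s)).hasFDerivAt.comp_hasDerivAt x
      ((hasDerivAt_id x).prodMk (hasDerivAt_const x s))).deriv
  have h1 := contDiff_slice hΦ s
  have h2 := contDiff_slice (contDiff_fderiv_apply hΦ (1, 0)) s
  have := congrFun (Real.fourier_deriv
    (h1.continuous.integrable_of_hasCompactSupport (hc.slice s)) (h1.differentiable (by simp))
    (by rw [hd]; exact h2.continuous.integrable_of_hasCompactSupport
          ((hc.fderiv_apply ℝ (1, 0)).slice s))) ξ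
  rw [hd] at this
  simpa using this

/-- The trace inequality with `r = m` has right side `(1/δ + m)∫|f|² + m⁻¹∫|g|²`. Multiplication by
`m²/(1 + m)` turns this into at most `1/δ + 1` times `∫ m²|f|² + |g|²`, uniformly in `m`. -/
theorem dnMultiplier_sq_mul_le {δ : ℝ} (hδ : 0 < δ) {f g : ℝ → ℂ}
    (hf : ∀ t, HasDerivAt f (g t) t) (hg : Continuous g) (k ξ : ℝ) :
    ‖(dnMultiplier k ξ : ℂ) * f 0‖ₑ ^ 2 ≤ ENNReal.ofReal (1 / δ + 1) *
      ∫⁻ s in Set.Ioo (-δ) 0, (ENNReal.ofReal (freq k ξ ^ 2) * ‖f s‖ₑ ^ 2 + ‖g s‖ₑ ^ 2) := by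
  have hfc : Continuous f := continuous_iff_continuousAt.2 fun t => (hf t).continuousAt
  set m := freq k ξ with hm
  -- At `m = 0` the choice `r = m` is not allowed, but the multiplier vanishes there.
  rcases (freq_nonneg k ξ).eq_or_lt with h0 | h0
  · have : dnMultiplier k ξ = 0 := by rw [dnMultiplier, ← h0, zero_div]
    simp [this]
  rw [← hm] at h0
  rw [enorm_mul, mul_pow, enorm_sq_eq_ofReal (dnMultiplier k ξ : ℂ), Complex.norm_real,
    Real.norm_eq_abs, sq_abs, dnMultiplier_sq, ← hm]
  refine (mul_le_mul_right (enorm_sq_endpoint_le hf hg (neg_lt_zero.2 hδ) h0) _).trans ?_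
  rw [lintegral_add_left (by fun_prop), lintegral_const_mul _ (by fun_prop), mul_add, mul_add,
    ← mul_assoc, ← mul_assoc, ← mul_assoc, ← ENNReal.ofReal_mul (by positivity),
    ← ENNReal.ofReal_mul (by positivity), ← ENNReal.ofReal_mul (by positivity), sub_neg_eq_add,
    zero_add]
  have hd : 0 < 1 / δ := by positivity
  gcongr ENNReal.ofReal ?_ * _ + ENNReal.ofReal ?_ * _
  · rw [div_mul_eq_mul_div, div_le_iff₀ (by positivity)]
    have : 0 ≤ m ^ 2 * (1 / δ * m + 1) := by positivity
    nlinarith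
  · rw [div_mul_eq_mul_div, div_le_iff₀ (by positivity), sq, mul_assoc, mul_inv_cancel₀ h0.ne']
    nlinarith

theorem lintegral_enorm_sq_add {f g h : ℝ → ℂ} (hf : Continuous f) (hg : Continuous g)
    (c : ENNReal) :
    ∫⁻ x, (‖f x‖ₑ ^ 2 + c * ‖g x‖ₑ ^ 2 + ‖h x‖ₑ ^ 2)
      = (∫⁻ x, ‖f x‖ₑ ^ 2) + c * (∫⁻ x, ‖g x‖ₑ ^ 2) + ∫⁻ x, ‖h x‖ₑ ^ 2 := by
  rw [lintegral_add_left (by fun_prop), lintegral_add_left (by fun_prop),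
    lintegral_const_mul _ (by fun_prop)]

/-- The estimate at fixed `ξ` is integrated over `ξ`, the integrals are exchanged, and Plancherel is
applied on each horizontal line; the part `(2πξ)²` of `m²` becomes the `x`-derivative. -/
theorem dnEnergy_fourier_slice_le (hΦ : ContDiff ℝ ∞ Φ) (hc : HasCompactSupport Φ) {δ : ℝ}
    (hδ : 0 < δ) (k : ℝ) :
    dnEnergy k (𝓕 fun x => Φ (x, 0)) ≤ ENNReal.ofReal (1 / δ + 1) *
      ∫⁻ s in Set.Ioo (-δ) 0, ∫⁻ x, (‖fderiv ℝ Φ (x, s) (1, 0)‖ₑ ^ 2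
        + ENNReal.ofReal (k ^ 2) * ‖Φ (x, s)‖ₑ ^ 2 + ‖fderiv ℝ Φ (x, s) (0, 1)‖ₑ ^ 2) := by
  have d1 := contDiff_fderiv_apply hΦ (1, 0)
  have d2 := contDiff_fderiv_apply hΦ (0, 1)
  have s1 := hc.fderiv_apply ℝ (1, 0)
  have s2 := hc.fderiv_apply ℝ (0, 1)
  have c0 := continuous_fourier_slice hΦ.continuous hc
  have c1 := continuous_fourier_slice d1.continuous s1
  have c2 := continuous_fourier_slice d2.continuous s2
  have key : ∀ ξ, ‖(dnMultiplier k ξ : ℂ) * 𝓕 (fun x => Φ (x, 0)) ξ‖ₑ ^ 2 ≤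
      ENNReal.ofReal (1 / δ + 1) * ∫⁻ s in Set.Ioo (-δ) 0,
        (‖𝓕 (fun x => fderiv ℝ Φ (x, s) (1, 0)) ξ‖ₑ ^ 2
          + ENNReal.ofReal (k ^ 2) * ‖𝓕 (fun x => Φ (x, s)) ξ‖ₑ ^ 2
          + ‖𝓕 (fun x => fderiv ℝ Φ (x, s) (0, 1)) ξ‖ₑ ^ 2) := fun ξ => by
    refine (dnMultiplier_sq_mul_le hδ (hasDerivAt_fourier_slice hΦ hc ξ)
      (continuous_fourier_slice_right d2.continuous s2 ξ) k ξ).trans_eq ?_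
    congr 1
    refine lintegral_congr fun s => ?_
    congr 1
    rw [fourier_slice_dx hΦ hc, enorm_mul, mul_pow, ← add_mul, freq_sq,
      ENNReal.ofReal_add (by positivity) (by positivity),
      enorm_sq_eq_ofReal (2 * (Real.pi : ℂ) * Complex.I * ξ)]
    congr 3
    simp [mul_pow]
  refine (lintegral_mono key).trans ?_
  rw [lintegral_const_mul' _ _ ENNReal.ofReal_ne_top, lintegral_lintegral_swap]
  · refine mul_le_mul_right (lintegral_mono fun s => ?_) _
    have m0 := (contDiff_slice hΦ s).continuous
    have m1 := (contDiff_slice d1 s).continuous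
    have n0 := continuous_fourier_slice_left hΦ.continuous hc s
    have n1 := continuous_fourier_slice_left d1.continuous s1 s
    refine ((lintegral_enorm_sq_add n1 n0 _).trans ?_).trans
      (lintegral_enorm_sq_add m1 m0 _).symm |>.le
    rw [lintegral_enorm_sq_fourier (contDiff_slice d1 s) (s1.slice s),
      lintegral_enorm_sq_fourier (contDiff_slice hΦ s) (hc.slice s),
      lintegral_enorm_sq_fourier (contDiff_slice d2 s) (s2.slice s)]
  · refine Measurable.aemeasurable ?_
    simp only [Function.uncurry_def]
    exact ((c1.measurable.enorm.pow_const 2).add ((c0.measurable.enorm.pow_const 2).const_mul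
      _)).add (c2.measurable.enorm.pow_const 2)

end Strip

/-! ### Straightening the surface, and the lower estimate in the fluid. -/

/-- The map which straightens the surface. -/
def shear (η : ℝ → ℝ) (p : ℝ × ℝ) : ℝ × ℝ := (p.1, η p.1 + p.2)

theorem contDiff_shear {η : ℝ → ℝ} (hη : ContDiff ℝ ∞ η) : ContDiff ℝ ∞ (shear η) :=
  contDiff_fst.prodMk ((hη.comp contDiff_fst).add contDiff_snd)

theorem HasCompactSupport.comp_shear {E : Type*} [Zero E] {η : ℝ → ℝ} (hη : Continuous η)
    {ψ : ℝ × ℝ → E} (hc : HasCompactSupport ψ) : HasCompactSupport (ψ ∘ shear η) := by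
  have h : Continuous fun p : ℝ × ℝ => (p.1, p.2 - η p.1) := by fun_prop
  refine HasCompactSupport.intro (hc.isCompact.image h) fun p hp => ?_
  by_contra h'
  exact hp ⟨shear η p, subset_tsupport _ h', by simp [shear]⟩

theorem fderiv_comp_shear {η : ℝ → ℝ} (hη : ContDiff ℝ ∞ η) {ψ : ℝ × ℝ → ℂ}
    (hψ : ContDiff ℝ ∞ ψ) (p e : ℝ × ℝ) :
    fderiv ℝ (ψ ∘ shear η) p e = fderiv ℝ ψ (shear η p) (e.1, deriv η p.1 * e.1 + e.2) := by
  have h1 : HasFDerivAt (shear η) ((ContinuousLinearMap.fst ℝ ℝ ℝ).prod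
      (deriv η p.1 • ContinuousLinearMap.fst ℝ ℝ ℝ + ContinuousLinearMap.snd ℝ ℝ ℝ)) p :=
    hasFDerivAt_fst.prodMk (((hη.differentiable (by simp) p.1).hasDerivAt.comp_hasFDerivAt p
      hasFDerivAt_fst).add hasFDerivAt_snd)
  rw [((hψ.differentiable (by simp) (shear η p)).hasFDerivAt.comp p h1).fderiv]
  simp

/-- The layer of thickness `δ` under the surface lies in the fluid, and the shear is a translation
on each vertical line. -/
theorem lintegral_shear_strip_le {η : ℝ → ℝ} (hη : Continuous η) {δ : ℝ}
    (hpos : ∀ x, δ ≤ 1 + η x) {g : ℝ × ℝ → ENNReal} (hg : Measurable g) :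
    ∫⁻ s in Set.Ioo (-δ) 0, ∫⁻ x, g (shear η (x, s)) ≤ ∫⁻ p in fluidDomain η, g p := by
  have hm : Measurable (shear η) :=
    (show Continuous (shear η) by unfold shear; fun_prop).measurable
  rw [lintegral_lintegral_swap, lintegral_fluidDomain hη hg]
  · refine lintegral_mono fun x => ?_
    rw [← lintegral_indicator measurableSet_Ioo, ← lintegral_indicator measurableSet_Ioo]
    refine le_trans (lintegral_mono fun s => ?_) (lintegral_add_left_eq_self _ (η x)).le
    by_cases hs : s ∈ Set.Ioo (-δ) 0
    · have : η x + s ∈ Set.Ioo (-1) (η x) :=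
        ⟨by linarith [hpos x, hs.1], by linarith [hs.2]⟩
      rw [Set.indicator_of_mem hs, Set.indicator_of_mem this]
      rfl
    · simp [Set.indicator_of_notMem hs]
  · exact (hg.comp (hm.comp measurable_swap)).aemeasurable

theorem enorm_energyMap_sq {η : ℝ → ℝ} (k : ℝ) (x : TraceData η) :
    ‖energyMap η k x‖ₑ ^ 2
      = ‖x.2.1‖ₑ ^ 2 + ‖x.2.2.1‖ₑ ^ 2 + ENNReal.ofReal (k ^ 2) * ‖x.1‖ₑ ^ 2 := by
  rw [enorm_sq_eq_ofReal, norm_energyMap_sq, ENNReal.ofReal_add (by positivity) (by positivity),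
    ENNReal.ofReal_add (by positivity) (by positivity), ENNReal.ofReal_mul (by positivity),
    enorm_sq_eq_ofReal, enorm_sq_eq_ofReal, enorm_sq_eq_ofReal]

theorem enorm_energyMap_sq_eq_lintegral {η : ℝ → ℝ} (k : ℝ) {x : TraceData η}
    {f g h : ℝ × ℝ → ℂ} (hf : x.1 =ᵐ[volume.restrict (fluidDomain η)] f)
    (hg : x.2.1 =ᵐ[volume.restrict (fluidDomain η)] g)
    (hh : x.2.2.1 =ᵐ[volume.restrict (fluidDomain η)] h) (hgc : Continuous g)
    (hhc : Continuous h) :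
    ‖energyMap η k x‖ₑ ^ 2 = ∫⁻ p in fluidDomain η,
      (‖g p‖ₑ ^ 2 + ‖h p‖ₑ ^ 2 + ENNReal.ofReal (k ^ 2) * ‖f p‖ₑ ^ 2) := by
  rw [enorm_energyMap_sq, enorm_sq_eq_lintegral hf, enorm_sq_eq_lintegral hg,
    enorm_sq_eq_lintegral hh, ← lintegral_const_mul' _ _ ENNReal.ofReal_ne_top,
    lintegral_add_left (by fun_prop), lintegral_add_left (by fun_prop)]

theorem enorm_add_mul_sq_le {a b : ℂ} {t M : ℝ} (ht : |t| ≤ M) :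
    ‖a + t * b‖ₑ ^ 2 ≤ ENNReal.ofReal 2 * ‖a‖ₑ ^ 2 + ENNReal.ofReal (2 * M ^ 2) * ‖b‖ₑ ^ 2 := by
  rw [enorm_sq_eq_ofReal, enorm_sq_eq_ofReal, enorm_sq_eq_ofReal,
    ← ENNReal.ofReal_mul (by positivity), ← ENNReal.ofReal_mul (by positivity),
    ← ENNReal.ofReal_add (by positivity) (by positivity)]
  refine ENNReal.ofReal_le_ofReal ?_
  have h1 : ‖a + t * b‖ ≤ ‖a‖ + M * ‖b‖ := by
    refine (norm_add_le _ _).trans ?_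
    rw [norm_mul, Complex.norm_real, Real.norm_eq_abs]
    gcongr
  have h2 := pow_le_pow_left₀ (norm_nonneg _) h1 2
  nlinarith [sq_nonneg (‖a‖ - M * ‖b‖)]

theorem enorm_fderiv_comp_shear_le {η : ℝ → ℝ} (hη : ContDiff ℝ ∞ η) {M : ℝ}
    (hM : ∀ x, |deriv η x| ≤ M) {ψ : ℝ × ℝ → ℂ} (hψ : ContDiff ℝ ∞ ψ) (c : ENNReal)
    (p : ℝ × ℝ) :
    ‖fderiv ℝ (ψ ∘ shear η) p (1, 0)‖ₑ ^ 2 + ‖fderiv ℝ (ψ ∘ shear η) p (0, 1)‖ₑ ^ 2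
      + c * ‖(ψ ∘ shear η) p‖ₑ ^ 2
      ≤ ENNReal.ofReal (2 + 2 * M ^ 2) * (‖fderiv ℝ ψ (shear η p) (1, 0)‖ₑ ^ 2
        + ‖fderiv ℝ ψ (shear η p) (0, 1)‖ₑ ^ 2 + c * ‖ψ (shear η p)‖ₑ ^ 2) := by
  have e : fderiv ℝ (ψ ∘ shear η) p (1, 0) = fderiv ℝ ψ (shear η p) (1, 0)
      + (deriv η p.1 : ℝ) * fderiv ℝ ψ (shear η p) (0, 1) := by
    rw [fderiv_comp_shear hη hψ, ← Complex.real_smul, ← map_smul, ← map_add]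
    congr 1
    simp
  have e' : fderiv ℝ (ψ ∘ shear η) p (0, 1) = fderiv ℝ ψ (shear η p) (0, 1) := by
    rw [fderiv_comp_shear hη hψ]
    simp
  rw [e, e', Function.comp_apply, mul_add, mul_add]
  have h1 : ENNReal.ofReal 2 ≤ ENNReal.ofReal (2 + 2 * M ^ 2) :=
    ENNReal.ofReal_le_ofReal (by nlinarith [sq_nonneg M])
  have h2 : ENNReal.ofReal (2 * M ^ 2) + 1 ≤ ENNReal.ofReal (2 + 2 * M ^ 2) := by
    rw [← ENNReal.ofReal_one, ← ENNReal.ofReal_add (by positivity) zero_le_one]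
    exact ENNReal.ofReal_le_ofReal (by linarith)
  have h3 : 1 ≤ ENNReal.ofReal (2 + 2 * M ^ 2) := le_add_self.trans h2
  calc _ ≤ (ENNReal.ofReal 2 * ‖fderiv ℝ ψ (shear η p) (1, 0)‖ₑ ^ 2
          + ENNReal.ofReal (2 * M ^ 2) * ‖fderiv ℝ ψ (shear η p) (0, 1)‖ₑ ^ 2)
          + ‖fderiv ℝ ψ (shear η p) (0, 1)‖ₑ ^ 2 + c * ‖ψ (shear η p)‖ₑ ^ 2 := by
        gcongr
        exact enorm_add_mul_sq_le (hM _)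
    _ = ENNReal.ofReal 2 * ‖fderiv ℝ ψ (shear η p) (1, 0)‖ₑ ^ 2
          + (ENNReal.ofReal (2 * M ^ 2) + 1) * ‖fderiv ℝ ψ (shear η p) (0, 1)‖ₑ ^ 2
          + 1 * (c * ‖ψ (shear η p)‖ₑ ^ 2) := by ring
    _ ≤ _ := by gcongr

theorem dnEnergy_congr {k : ℝ} {f g : ℝ → ℂ} (h : f =ᵐ[volume] g) :
    dnEnergy k f = dnEnergy k g := by
  refine lintegral_congr_ae ?_
  filter_upwards [h] with ξ hξ
  rw [hξ]

theorem dnEnergy_le_of_mem_smoothTraceData {η : ℝ → ℝ} (hη : ContDiff ℝ ∞ η) {M δ : ℝ}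
    (hM : ∀ x, |deriv η x| ≤ M) (hδ : 0 < δ) (hpos : ∀ x, δ ≤ 1 + η x) (k : ℝ)
    {x : TraceData η} (hx : x ∈ smoothTraceData η) :
    dnEnergy k (𝓕 x.2.2.2 : Lp ℂ 2 (volume : Measure ℝ)) ≤
      ENNReal.ofReal ((1 / δ + 1) * (2 + 2 * M ^ 2)) * ‖energyMap η k x‖ₑ ^ 2 := by
  obtain ⟨ψ, hψ, hc, h1, h2, h3, h4⟩ := hx
  have c0 := hψ.continuous
  have c1 := continuous_fderiv_apply_of_contDiff hψ (1, 0)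
  have c2 := continuous_fderiv_apply_of_contDiff hψ (0, 1)
  have hΦ := hψ.comp (contDiff_shear hη)
  have hΦc := hc.comp_shear hη.continuous
  have e0 : (fun t => ψ (t, η t)) = fun t => (ψ ∘ shear η) (t, 0) := by
    ext t
    simp [shear]
  rw [e0] at h4
  rw [dnEnergy_congr (fourier_ae_eq_of_ae_eq (contDiff_slice hΦ 0) (hΦc.slice 0) h4),
    enorm_energyMap_sq_eq_lintegral k h1 h2 h3 c1 c2, ENNReal.ofReal_mul (by positivity), mul_assoc]
  refine (dnEnergy_fourier_slice_le hΦ hΦc hδ k).trans (mul_le_mul_right ?_ _)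
  have hmeas : Measurable fun p => ENNReal.ofReal (2 + 2 * M ^ 2) *
      (‖fderiv ℝ ψ p (1, 0)‖ₑ ^ 2 + ‖fderiv ℝ ψ p (0, 1)‖ₑ ^ 2
        + ENNReal.ofReal (k ^ 2) * ‖ψ p‖ₑ ^ 2) := by fun_prop
  rw [← lintegral_const_mul' _ _ ENNReal.ofReal_ne_top]
  refine le_trans (lintegral_mono fun s => lintegral_mono fun t => ?_)
    (lintegral_shear_strip_le hη.continuous hpos hmeas)
  rw [add_right_comm]
  exact enorm_fderiv_comp_shear_le hη hM hψ _ (t, s)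

/-- The multiplier is unbounded, so `dnEnergy` is not continuous on `L²`. It is lower
semicontinuous, by almost everywhere convergence of a subsequence and Fatou's lemma. -/
theorem dnEnergy_le_liminf {k : ℝ} {f : ℕ → Lp ℂ 2 (volume : Measure ℝ)}
    {g : Lp ℂ 2 (volume : Measure ℝ)} (hf : Tendsto f atTop (𝓝 g)) {b : ℕ → ENNReal}
    {B : ENNReal} (hb : Tendsto b atTop (𝓝 B)) (h : ∀ n, dnEnergy k (f n) ≤ b n) :
    dnEnergy k g ≤ B := by
  obtain ⟨ns, hns, hae⟩ := (tendstoInMeasure_of_tendsto_Lp hf).exists_seq_tendsto_ae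
  have hm := (continuous_dnMultiplier k).measurable
  calc dnEnergy k g
      = ∫⁻ ξ, liminf (fun n => ‖(dnMultiplier k ξ : ℂ) * f (ns n) ξ‖ₑ ^ 2) atTop := by
        refine lintegral_congr_ae ?_
        filter_upwards [hae] with ξ hξ
        have := (((ENNReal.continuous_pow 2).comp continuous_enorm).tendsto _).comp
          (hξ.const_mul (dnMultiplier k ξ : ℂ))
        exact this.liminf_eq.symm
    _ ≤ liminf (fun n => dnEnergy k (f (ns n))) atTop := by
        refine lintegral_liminf_le fun n => ?_
        have := (Lp.stronglyMeasurable (f (ns n))).measurable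
        fun_prop
    _ ≤ liminf (fun n => b (ns n)) atTop :=
        liminf_le_liminf (Eventually.of_forall fun n => h (ns n))
    _ = B := (hb.comp hns.tendsto_atTop).liminf_eq

theorem dnEnergy_le_of_mem_traceGraph {η : ℝ → ℝ} (hη : ContDiff ℝ ∞ η) {M δ : ℝ}
    (hM : ∀ x, |deriv η x| ≤ M) (hδ : 0 < δ) (hpos : ∀ x, δ ≤ 1 + η x) (k : ℝ)
    {x : TraceData η} (hx : x ∈ traceGraph η) :
    dnEnergy k (𝓕 x.2.2.2 : Lp ℂ 2 (volume : Measure ℝ)) ≤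
      ENNReal.ofReal ((1 / δ + 1) * (2 + 2 * M ^ 2)) * ‖energyMap η k x‖ₑ ^ 2 := by
  obtain ⟨y, hy, hlim⟩ := mem_closure_iff_seq_limit.1 hx
  refine dnEnergy_le_liminf (f := fun n => 𝓕 (y n).2.2.2) ?_
    (ENNReal.Tendsto.const_mul (((ENNReal.continuous_pow 2).comp
      (energyMap η k).continuous.enorm).tendsto x |>.comp hlim)
      (Or.inr ENNReal.ofReal_ne_top))
    fun n => dnEnergy_le_of_mem_smoothTraceData hη hM hδ hpos k (hy n)
  have h1 : Continuous fun x : TraceData η => x.2.2.2 := by fun_prop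
  exact (((Lp.fourierTransformₗᵢ ℝ ℂ).continuous.comp h1).tendsto x).comp hlim

theorem dnNorm_sq_le_of_mem_traceGraph {η : ℝ → ℝ} (hη : ContDiff ℝ ∞ η) {M δ : ℝ}
    (hM : ∀ x, |deriv η x| ≤ M) (hδ : 0 < δ) (hpos : ∀ x, δ ≤ 1 + η x) (k : ℝ) (u : Hhalf)
    {x : TraceData η} (hx : x ∈ traceGraph η) (hu : x.2.2.2 = u) :
    ((1 / δ + 1) * (2 + 2 * M ^ 2))⁻¹ * dnNorm k u ^ 2 ≤ ‖energyMap η k x‖ ^ 2 := by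
  have h := dnEnergy_le_of_mem_traceGraph hη hM hδ hpos k hx
  rw [hu, enorm_sq_eq_ofReal, ← ENNReal.ofReal_mul (by positivity)] at h
  rw [inv_mul_le_iff₀ (by positivity), dnNorm_sq]
  exact ENNReal.toReal_le_of_le_ofReal (by positivity) h

/-! ### Truncation of smooth functions. -/

theorem tendsto_eLpNorm_zero_of_dominated {α : Type*} [MeasurableSpace α] {μ : Measure α}
    {F : ℕ → α → ℂ} {g : α → ℝ} (hF : ∀ n, AEStronglyMeasurable (F n) μ) (hg : MemLp g 2 μ)
    (h : ∀ n p, ‖F n p‖ ≤ g p) (hlim : ∀ p, Tendsto (fun n => F n p) atTop (𝓝 0)) :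
    Tendsto (fun n => eLpNorm (F n) 2 μ) atTop (𝓝 0) := by
  have h1 : Tendsto (fun n => ∫⁻ p, ‖F n p‖ₑ ^ 2 ∂μ) atTop (𝓝 (∫⁻ _, 0 ∂μ)) := by
    refine tendsto_lintegral_of_dominated_convergence' (fun p => ‖g p‖ₑ ^ 2)
      (fun n => (hF n).enorm.pow_const 2) (fun n => Eventually.of_forall fun p => ?_) ?_
      (Eventually.of_forall fun p => ?_)
    · have : ‖F n p‖ₑ ≤ ‖g p‖ₑ :=
        enorm_le_iff_norm_le.2 ((h n p).trans (le_abs_self _))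
      exact pow_le_pow_left' this 2
    · have := hg.2
      rw [eLpNorm_eq_lintegral_rpow_enorm_toReal (by simp) (by simp)] at this
      intro h'
      simp [h'] at this
    · have := (((ENNReal.continuous_pow 2).comp continuous_enorm).tendsto _).comp (hlim p)
      simpa [Function.comp_def] using this
  rw [lintegral_zero] at h1
  have h2 := (ENNReal.continuous_rpow_const (y := 1 / 2)).tendsto 0 |>.comp h1
  rw [ENNReal.zero_rpow_of_pos (by norm_num)] at h2
  refine h2.congr fun n => ?_
  rw [eLpNorm_eq_lintegral_rpow_enorm_toReal (by simp) (by simp)]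
  simp

/-- Smooth square integrable functions with square integrable derivatives and surface values
define elements of the graph of the trace operator. -/
theorem mem_traceGraph_of_contDiff {η : ℝ → ℝ} (hη : Continuous η) {w : ℝ × ℝ → ℂ}
    (hw : ContDiff ℝ ∞ w) {x : TraceData η}
    (h1 : x.1 =ᵐ[volume.restrict (fluidDomain η)] w)
    (h2 : x.2.1 =ᵐ[volume.restrict (fluidDomain η)] fun p => fderiv ℝ w p (1, 0))
    (h3 : x.2.2.1 =ᵐ[volume.restrict (fluidDomain η)] fun p => fderiv ℝ w p (0, 1))
    (h4 : x.2.2.2 =ᵐ[volume] fun t => w (t, η t)) : x ∈ traceGraph η := by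
  let χ : ContDiffBump (0 : ℝ × ℝ) := ⟨1, 2, by norm_num, by norm_num⟩
  have hχ : ContDiff ℝ ∞ χ := χ.contDiff
  have hχ1 : ∀ p, ‖χ p‖ ≤ 1 := fun p => by
    rw [Real.norm_eq_abs, abs_of_nonneg χ.nonneg]
    exact χ.le_one
  obtain ⟨B, hB⟩ := (hχ.continuous_fderiv (by simp)).bounded_above_of_compact_support
    (χ.hasCompactSupport.fderiv ℝ)
  have hB0 : 0 ≤ B := (norm_nonneg _).trans (hB 0)
  -- The cutoff `χ (a n • p)` spreads over the plane, and a derivative falling on it gains the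
  -- factor `a n`. Since `a n ≤ 1`, the error has a dominating function independent of `n`.
  let a : ℕ → ℝ := fun n => 1 / ((n : ℝ) + 1)
  have ha : ∀ n, 0 < a n := fun n => by positivity
  have ha1 : ∀ n, a n ≤ 1 := fun n => by
    rw [div_le_one (by positivity)]
    linarith [(n.cast_nonneg : (0 : ℝ) ≤ n)]
  have ha0 : Tendsto a atTop (𝓝 0) := tendsto_one_div_add_atTop_nhds_zero_nat
  have hap : ∀ p : ℝ × ℝ, Tendsto (fun n => a n • p) atTop (𝓝 0) := fun p => by
    simpa using ha0.smul_const p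
  let ψ : ℕ → ℝ × ℝ → ℂ := fun n p => χ (a n • p) • w p
  have hχn : ∀ n, ContDiff ℝ ∞ fun p => χ (a n • p) := fun n =>
    hχ.comp (contDiff_const_smul _)
  have hψ : ∀ n, ContDiff ℝ ∞ (ψ n) := fun n => (hχn n).smul hw
  have hψc : ∀ n, HasCompactSupport (ψ n) := fun n =>
    (χ.hasCompactSupport.comp_homeomorph (Homeomorph.smulOfNeZero (a n) (ha n).ne')).smul_right
  have hχlim : ∀ p : ℝ × ℝ, Tendsto (fun n => χ (a n • p)) atTop (𝓝 1) := fun p => by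
    have := (hχ.continuous.tendsto 0).comp (hap p)
    rwa [χ.one_of_mem_closedBall (by simp [χ])] at this
  have hdlim : ∀ p e : ℝ × ℝ, Tendsto (fun n => fderiv ℝ (ψ n) p e) atTop
      (𝓝 (fderiv ℝ w p e)) ∧ ∀ n, ‖fderiv ℝ (ψ n) p e - fderiv ℝ w p e‖ ≤
        2 * ‖fderiv ℝ w p e‖ + B * ‖e‖ * ‖w p‖ := fun p e => by
    have hd : ∀ n, fderiv ℝ (ψ n) p e = χ (a n • p) • fderiv ℝ w p e
        + (a n * fderiv ℝ χ (a n • p) e) • w p := fun n => by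
      have e1 : HasFDerivAt (fun p => χ (a n • p))
          ((fderiv ℝ χ (a n • p)).comp (a n • ContinuousLinearMap.id ℝ (ℝ × ℝ))) p :=
        (hχ.differentiable (by simp) (a n • p)).hasFDerivAt.comp p
          ((hasFDerivAt_id p).const_smul (a n))
      have e2 : HasFDerivAt (ψ n) _ p := e1.smul (hw.differentiable (by simp) p).hasFDerivAt
      rw [e2.fderiv]
      simp
    have hb : ∀ n, ‖fderiv ℝ χ (a n • p) e‖ ≤ B * ‖e‖ := fun n =>
      (ContinuousLinearMap.le_opNorm _ _).trans (by gcongr; exact hB _)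
    constructor
    · simp only [hd]
      have l1 := (hχlim p).smul_const (fderiv ℝ w p e)
      have l2 : Tendsto (fun n => a n * fderiv ℝ χ (a n • p) e) atTop (𝓝 0) := by
        have hc : Continuous fun q => fderiv ℝ χ q e :=
          (hχ.continuous_fderiv (by simp)).clm_apply continuous_const
        simpa using ha0.mul ((hc.tendsto 0).comp (hap p))
      simpa using l1.add (l2.smul_const (w p))
    · intro n
      rw [hd]
      have b1 : ‖χ (a n • p) • fderiv ℝ w p e‖ ≤ ‖fderiv ℝ w p e‖ := by
        rw [norm_smul]
        exact mul_le_of_le_one_left (norm_nonneg _) (hχ1 _)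
      have b2 : ‖(a n * fderiv ℝ χ (a n • p) e) • w p‖ ≤ B * ‖e‖ * ‖w p‖ := by
        rw [norm_smul, norm_mul, Real.norm_of_nonneg (ha n).le]
        exact mul_le_mul_of_nonneg_right
          ((mul_le_of_le_one_left (norm_nonneg _) (ha1 n)).trans (hb n)) (norm_nonneg _)
      refine (norm_sub_le _ _).trans ?_
      have := norm_add_le (χ (a n • p) • fderiv ℝ w p e)
        ((a n * fderiv ℝ χ (a n • p) e) • w p)
      linarith
  have hvlim : ∀ p, Tendsto (fun n => ψ n p - w p) atTop (𝓝 0) := fun p => by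
    simpa [ψ] using ((hχlim p).smul_const (w p)).sub_const (w p)
  have hvb : ∀ n p, ‖ψ n p - w p‖ ≤ 2 * ‖w p‖ := fun n p => by
    refine (norm_sub_le _ _).trans ?_
    have : ‖ψ n p‖ ≤ ‖w p‖ := by
      simp only [ψ, norm_smul]
      exact mul_le_of_le_one_left (norm_nonneg _) (hχ1 _)
    linarith
  have m1 : MemLp w 2 (volume.restrict (fluidDomain η)) := (memLp_congr_ae h1).1 (Lp.memLp _)
  have m2 := (memLp_congr_ae h2).1 (Lp.memLp _)
  have m3 := (memLp_congr_ae h3).1 (Lp.memLp _)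
  have m4 := (memLp_congr_ae h4).1 (Lp.memLp _)
  have hc : Continuous w := hw.continuous
  have n1 := fun n => memLp_restrict_of_continuous (η := η) (hψ n).continuous (hψc n)
  have n2 := fun n => memLp_restrict_of_continuous (η := η)
    (continuous_fderiv_apply_of_contDiff (hψ n) (1, 0)) ((hψc n).fderiv_apply ℝ _)
  have n3 := fun n => memLp_restrict_of_continuous (η := η)
    (continuous_fderiv_apply_of_contDiff (hψ n) (0, 1)) ((hψc n).fderiv_apply ℝ _)
  have n4 := fun n => memLp_trace hη (hψ n).continuous (hψc n)
  have t1 : Tendsto (fun n => (n1 n).toLp (ψ n)) atTop (𝓝 x.1) := by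
    rw [tendsto_toLp_iff n1]
    refine (tendsto_eLpNorm_zero_of_dominated (fun n => (n1 n).1.sub m1.1) (m1.norm.const_mul 2)
      hvb hvlim).congr fun n => eLpNorm_congr_ae ?_
    filter_upwards [h1] with p hp
    simp [hp]
  have t2 : Tendsto (fun n => (n2 n).toLp _) atTop (𝓝 x.2.1) := by
    rw [tendsto_toLp_iff n2]
    refine (tendsto_eLpNorm_zero_of_dominated (fun n => (n2 n).1.sub m2.1)
      ((m2.norm.const_mul 2).add (m1.norm.const_mul (B * ‖((1, 0) : ℝ × ℝ)‖)))
      (fun n p => (hdlim p (1, 0)).2 n) fun p => ?_).congr fun n => eLpNorm_congr_ae ?_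
    · simpa using (hdlim p (1, 0)).1.sub_const (fderiv ℝ w p (1, 0))
    · filter_upwards [h2] with p hp
      simp [hp]
  have t3 : Tendsto (fun n => (n3 n).toLp _) atTop (𝓝 x.2.2.1) := by
    rw [tendsto_toLp_iff n3]
    refine (tendsto_eLpNorm_zero_of_dominated (fun n => (n3 n).1.sub m3.1)
      ((m3.norm.const_mul 2).add (m1.norm.const_mul (B * ‖((0, 1) : ℝ × ℝ)‖)))
      (fun n p => (hdlim p (0, 1)).2 n) fun p => ?_).congr fun n => eLpNorm_congr_ae ?_
    · simpa using (hdlim p (0, 1)).1.sub_const (fderiv ℝ w p (0, 1))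
    · filter_upwards [h3] with p hp
      simp [hp]
  have t4 : Tendsto (fun n => (n4 n).toLp _) atTop (𝓝 x.2.2.2) := by
    rw [tendsto_toLp_iff n4]
    refine (tendsto_eLpNorm_zero_of_dominated (fun n => (n4 n).1.sub m4.1)
      (m4.norm.const_mul 2) (fun n t => hvb n (t, η t))
      fun t => hvlim (t, η t)).congr fun n => eLpNorm_congr_ae ?_
    filter_upwards [h4] with t ht
    simp [ht]
  exact mem_closure_of_tendsto (t1.prodMk_nhds (t2.prodMk_nhds (t3.prodMk_nhds t4)))
    (Eventually.of_forall fun n => ⟨ψ n, hψ n, hψc n, (n1 n).coeFn_toLp, (n2 n).coeFn_toLp,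
      (n3 n).coeFn_toLp, (n4 n).coeFn_toLp⟩)

/-! ### Fourier synthesis in the horizontal variable. -/

/-- The integral is the convolution of `y ↦ f p (-y)` with the constant `1`, evaluated at `0`;
smoothness in `p` is that of convolutions with a parameter. -/
theorem contDiff_integral_of_compact {f : ℝ × ℝ → ℝ → ℂ}
    (hf : ContDiff ℝ ∞ (Function.uncurry f)) {K : Set ℝ} (hK : IsCompact K)
    (h : ∀ p, ∀ y ∉ K, f p y = 0) : ContDiff ℝ ∞ fun p => ∫ y, f p y := by
  have h1 := contDiffOn_convolution_right_with_param (𝕜 := ℝ) (n := ⊤) (μ := volume)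
    (f := fun _ : ℝ => (1 : ℂ)) (ContinuousLinearMap.mul ℝ ℂ) (g := fun p y => f p (-y))
    (s := Set.univ) (k := (fun y : ℝ => -y) '' K) isOpen_univ (hK.image continuous_neg)
    (fun p y _ hy => h p _ fun h' => hy ⟨-y, h', neg_neg y⟩)
    (continuous_const.locallyIntegrable) (by
      rw [Set.univ_prod_univ, contDiffOn_univ]
      exact hf.comp (contDiff_fst.prodMk contDiff_snd.neg))
  rw [Set.univ_prod_univ, contDiffOn_univ] at h1
  have h2 := h1.comp (contDiff_id.prodMk (contDiff_const (c := (0 : ℝ))))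
  convert! h2 using 1
  ext p
  simp [convolution]

section Synthesis

variable {A : ℝ × ℝ → ℂ} {K : Set ℝ}

/-- The function whose Fourier transform in the first variable is `A`. -/
def synthesis (A : ℝ × ℝ → ℂ) (p : ℝ × ℝ) : ℂ :=
  ∫ ξ, Complex.exp (↑(2 * Real.pi * p.1 * ξ) * Complex.I) * A (ξ, p.2)

theorem synthesis_eq (A : ℝ × ℝ → ℂ) (x s : ℝ) :
    synthesis A (x, s) = 𝓕 (fun ξ => A (ξ, s)) (-x) := by
  rw [Real.fourier_real_eq_integral_exp_smul]
  refine integral_congr_ae (Eventually.of_forall fun ξ => ?_)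
  simp only [smul_eq_mul]
  congr 4
  ring

theorem contDiff_synthesis (hA : ContDiff ℝ ∞ A) (hK : IsCompact K)
    (h : ∀ s, ∀ ξ ∉ K, A (ξ, s) = 0) : ContDiff ℝ ∞ (synthesis A) := by
  refine contDiff_integral_of_compact ?_ hK fun p ξ hξ => by simp [h p.2 ξ hξ]
  have h1 : ContDiff ℝ ∞ fun q : (ℝ × ℝ) × ℝ => A (q.2, q.1.2) :=
    hA.comp (contDiff_snd.prodMk (contDiff_snd.comp contDiff_fst))
  have h2 : ContDiff ℝ ∞ fun q : (ℝ × ℝ) × ℝ => (↑(2 * Real.pi * q.1.1 * q.2) : ℂ) :=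
    Complex.ofRealCLM.contDiff.comp
      (show ContDiff ℝ ∞ fun q : (ℝ × ℝ) × ℝ => 2 * Real.pi * q.1.1 * q.2 by fun_prop)
  exact (h2.mul contDiff_const).cexp.mul h1

theorem fderiv_synthesis_snd (hA : ContDiff ℝ ∞ A) (hK : IsCompact K)
    (h : ∀ s, ∀ ξ ∉ K, A (ξ, s) = 0) (x s : ℝ) :
    fderiv ℝ (synthesis A) (x, s) (0, 1) = synthesis (fun p => fderiv ℝ A p (0, 1)) (x, s) := by
  have c0 := hA.continuous
  have c1 := continuous_fderiv_apply_of_contDiff hA (0, 1)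
  have h' : ∀ s, ∀ ξ ∉ K, fderiv ℝ A (ξ, s) (0, 1) = 0 := fun s ξ hξ => by
    refine (hasDerivAt_slice hA ξ s).unique ?_
    simpa [h _ ξ hξ] using hasDerivAt_const s (0 : ℂ)
  refine (hasDerivAt_slice (contDiff_synthesis hA hK h) x s).unique ?_
  refine hasDerivAt_integral_of_compact
    (f := fun s ξ => Complex.exp (↑(2 * Real.pi * x * ξ) * Complex.I) * A (ξ, s))
    (f' := fun s ξ => Complex.exp (↑(2 * Real.pi * x * ξ) * Complex.I) *
      fderiv ℝ A (ξ, s) (0, 1)) ?_ ?_ (fun s ξ => ?_) hK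
    (fun s ξ hξ => by simp [h s ξ hξ]) (fun s ξ hξ => by simp [h' s ξ hξ]) s
  · simp only [Function.uncurry_def]
    fun_prop
  · simp only [Function.uncurry_def]
    exact (show Continuous fun p : ℝ × ℝ => Complex.exp (↑(2 * Real.pi * x * p.2) * Complex.I)
      by fun_prop).mul (c1.comp (show Continuous fun p : ℝ × ℝ => (p.2, p.1) by fun_prop))
  · exact (hasDerivAt_slice hA ξ s).const_mul _

theorem hasDerivAt_slice_fst {ψ : ℝ × ℝ → ℂ} (hψ : ContDiff ℝ ∞ ψ) (x z : ℝ) :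
    HasDerivAt (fun t => ψ (t, z)) (fderiv ℝ ψ (x, z) (1, 0)) x :=
  (hψ.differentiable (by simp) (x, z)).hasFDerivAt.comp_hasDerivAt x
    ((hasDerivAt_id x).prodMk (hasDerivAt_const x z))

theorem fderiv_synthesis_fst (hA : ContDiff ℝ ∞ A) (hK : IsCompact K)
    (h : ∀ s, ∀ ξ ∉ K, A (ξ, s) = 0) (x s : ℝ) :
    fderiv ℝ (synthesis A) (x, s) (1, 0)
      = synthesis (fun p => (2 * Real.pi * Complex.I * p.1) * A p) (x, s) := by
  have c0 := hA.continuous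
  refine (hasDerivAt_slice_fst (contDiff_synthesis hA hK h) x s).unique ?_
  refine hasDerivAt_integral_of_compact
    (f := fun x ξ => Complex.exp (↑(2 * Real.pi * x * ξ) * Complex.I) * A (ξ, s))
    (f' := fun x ξ => Complex.exp (↑(2 * Real.pi * x * ξ) * Complex.I) *
      ((2 * Real.pi * Complex.I * ξ) * A (ξ, s))) ?_ ?_ (fun x ξ => ?_) hK
    (fun x ξ hξ => by simp [h s ξ hξ]) (fun x ξ hξ => by simp [h s ξ hξ]) x
  · simp only [Function.uncurry_def]
    fun_prop
  · simp only [Function.uncurry_def]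
    fun_prop
  · have h1 : HasDerivAt (fun x : ℝ => (↑(2 * Real.pi * x * ξ) : ℂ) * Complex.I)
        (2 * Real.pi * Complex.I * ξ) x := by
      have := ((((hasDerivAt_id x).const_mul (2 * Real.pi)).mul_const ξ).ofReal_comp).mul_const
        Complex.I
      refine this.congr_deriv ?_
      push_cast
      ring
    refine (h1.cexp.mul_const (A (ξ, s))).congr_deriv ?_
    ring

theorem lintegral_enorm_sq_synthesis (hA : ContDiff ℝ ∞ A) (hK : IsCompact K)
    (h : ∀ s, ∀ ξ ∉ K, A (ξ, s) = 0) (s : ℝ) :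
    ∫⁻ x, ‖synthesis A (x, s)‖ₑ ^ 2 = ∫⁻ ξ, ‖A (ξ, s)‖ₑ ^ 2 := by
  simp only [synthesis_eq]
  rw [lintegral_neg_eq_self (fun x => ‖𝓕 (fun ξ => A (ξ, s)) x‖ₑ ^ 2),
    lintegral_enorm_sq_fourier (contDiff_slice hA s) (HasCompactSupport.intro hK (h s))]

end Synthesis

/-! ### Upper estimate by a Gaussian extension. -/

theorem lintegral_fluidDomain_comp_shear_le {η : ℝ → ℝ} (hη : Continuous η) {L : ℝ}
    (hL : ∀ x, 1 + η x ≤ L) {g : ℝ × ℝ → ENNReal} (hg : Measurable g) :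
    ∫⁻ p in fluidDomain η, g (shear (-η) p) ≤ ∫⁻ s in Set.Ioo (-L) 0, ∫⁻ x, g (x, s) := by
  have hm : Measurable (shear (-η)) :=
    (show Continuous (shear (-η)) by unfold shear; fun_prop).measurable
  rw [lintegral_lintegral_swap, lintegral_fluidDomain hη (g := fun p => g (shear (-η) p))
    (hg.comp hm)]
  · refine lintegral_mono fun x => ?_
    rw [← lintegral_indicator measurableSet_Ioo, ← lintegral_indicator measurableSet_Ioo]
    refine le_trans (lintegral_mono fun z => ?_) (lintegral_add_left_eq_self _ (-η x)).le
    by_cases hz : z ∈ Set.Ioo (-1) (η x)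
    · have : -η x + z ∈ Set.Ioo (-L) 0 :=
        ⟨by linarith [hL x, hz.1], by linarith [hz.2]⟩
      rw [Set.indicator_of_mem hz, Set.indicator_of_mem this]
      rfl
    · simp [Set.indicator_of_notMem hz]
  · exact (hg.comp measurable_swap).aemeasurable

/-- Trades the Gaussian profile for a rational weight whose vertical integral is explicit; the
exponential series to second order suffices. -/
theorem one_add_four_mul_sq_mul_exp_le (t : ℝ) (ht : 0 ≤ t) :
    (1 + 4 * t ^ 2) * Real.exp (-(2 * t ^ 2)) ≤ 8 * ((1 + t) ^ 2)⁻¹ := by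
  have h1 := Real.quadratic_le_exp_of_nonneg (x := 2 * t ^ 2) (by positivity)
  rw [Real.exp_neg, ← div_eq_mul_inv, ← div_eq_mul_inv,
    div_le_div_iff₀ (Real.exp_pos _) (by positivity)]
  have h2 : (1 + t) ^ 2 ≤ 2 * (1 + t ^ 2) := by nlinarith [sq_nonneg (1 - t)]
  calc (1 + 4 * t ^ 2) * (1 + t) ^ 2 ≤ (1 + 4 * t ^ 2) * (2 * (1 + t ^ 2)) := by gcongr
    _ ≤ 8 * (1 + 2 * t ^ 2 + (2 * t ^ 2) ^ 2 / 2) := by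
      nlinarith [sq_nonneg t, sq_nonneg (t ^ 2)]
    _ ≤ _ := by gcongr

theorem lintegral_inv_one_add_sq_le {m L : ℝ} (hm : 0 ≤ m) (hL : 1 ≤ L) :
    ∫⁻ s in Set.Ioo (-L) 0, ENNReal.ofReal ((1 + m * -s) ^ 2)⁻¹
      ≤ ENNReal.ofReal (L / (1 + m)) := by
  have hpos : ∀ s ∈ Set.Icc (-L) 0, 0 < 1 + m * -s := fun s hs => by
    have := mul_nonneg hm (neg_nonneg.2 hs.2)
    linarith
  have hc : ContinuousOn (fun s => ((1 + m * -s) ^ 2)⁻¹) (Set.Icc (-L) 0) :=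
    ContinuousOn.inv₀ (by fun_prop) fun s hs => (pow_pos (hpos s hs) 2).ne'
  have hL0 : -L ≤ 0 := by linarith
  have hi : ∫ s in (-L)..0, ((1 + m * -s) ^ 2)⁻¹ = L / (1 + m * L) := by
    -- This primitive, unlike `1 / (m * (1 - m s))`, also serves `m = 0`.
    rw [intervalIntegral.integral_eq_sub_of_hasDerivAt (f := fun s => s / (1 + m * -s))]
    · simp [neg_div]
    · intro s hs
      rw [Set.uIcc_of_le hL0] at hs
      have h1 : HasDerivAt (fun s => 1 + m * -s) (m * -1) s :=
        ((hasDerivAt_neg s).const_mul m).const_add 1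
      have h2 := (hasDerivAt_id s).div h1 (hpos s hs).ne'
      refine h2.congr_deriv ?_
      have := (hpos s hs).ne'
      simp only [id]
      field_simp
      ring
    · exact ContinuousOn.intervalIntegrable (by rwa [Set.uIcc_of_le hL0])
  rw [← ofReal_integral_eq_lintegral_ofReal, restrict_Ioo_eq_restrict_Ioc,
    ← intervalIntegral.integral_of_le hL0, hi]
  · refine ENNReal.ofReal_le_ofReal ?_
    gcongr
    exact le_mul_of_one_le_right hm hL
  · exact (hc.integrableOn_Icc).mono_set Set.Ioo_subset_Icc_self
  · exact Eventually.of_forall fun s => by positivity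

/-- The Fourier transform in the horizontal variable of the extension of a function with Fourier
transform `h`. -/
def gaussianSymbol (k : ℝ) (h : ℝ → ℂ) (p : ℝ × ℝ) : ℂ :=
  (Real.exp (-(((2 * Real.pi * p.1) ^ 2 + k ^ 2) * p.2 ^ 2)) : ℝ) * h p.1

section GaussianSymbol

variable {h : ℝ → ℂ}

/-- The exponent contains `m²`, a polynomial in `ξ`. The harmonic profile `exp(m s)` would not be
smooth at `ξ = 0` when `k = 0`. -/
theorem contDiff_gaussianSymbol (k : ℝ) (hh : ContDiff ℝ ∞ h) :
    ContDiff ℝ ∞ (gaussianSymbol k h) :=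
  (Complex.ofRealCLM.contDiff.comp (show ContDiff ℝ ∞ fun p : ℝ × ℝ =>
    Real.exp (-(((2 * Real.pi * p.1) ^ 2 + k ^ 2) * p.2 ^ 2)) by fun_prop)).mul
    (hh.comp contDiff_fst)

theorem norm_gaussianSymbol (k ξ s : ℝ) :
    ‖gaussianSymbol k h (ξ, s)‖ = Real.exp (-(freq k ξ ^ 2 * s ^ 2)) * ‖h ξ‖ := by
  rw [gaussianSymbol, norm_mul, Complex.norm_real, Real.norm_of_nonneg (Real.exp_pos _).le,
    freq_sq]

theorem norm_gaussianSymbol_le (k ξ s : ℝ) : ‖gaussianSymbol k h (ξ, s)‖ ≤ ‖h ξ‖ := by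
  rw [norm_gaussianSymbol]
  refine mul_le_of_le_one_left (norm_nonneg _) (Real.exp_le_one_iff.2 ?_)
  have : 0 ≤ freq k ξ ^ 2 * s ^ 2 := by positivity
  linarith

theorem fderiv_gaussianSymbol (hh : ContDiff ℝ ∞ h) (k ξ s : ℝ) :
    fderiv ℝ (gaussianSymbol k h) (ξ, s) (0, 1)
      = (-(2 * freq k ξ ^ 2 * s) : ℝ) * gaussianSymbol k h (ξ, s) := by
  refine (hasDerivAt_slice (contDiff_gaussianSymbol k hh) ξ s).unique ?_
  have h1 : HasDerivAt (fun s : ℝ => Real.exp (-(((2 * Real.pi * ξ) ^ 2 + k ^ 2) * s ^ 2)))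
      (-(2 * freq k ξ ^ 2 * s) * Real.exp (-(((2 * Real.pi * ξ) ^ 2 + k ^ 2) * s ^ 2))) s := by
    have h0 : HasDerivAt (fun s : ℝ => -(((2 * Real.pi * ξ) ^ 2 + k ^ 2) * s ^ 2))
        (-(((2 * Real.pi * ξ) ^ 2 + k ^ 2) * (2 * s))) s := by
      simpa using ((hasDerivAt_pow 2 s).const_mul ((2 * Real.pi * ξ) ^ 2 + k ^ 2)).fun_neg
    refine h0.exp.congr_deriv ?_
    rw [freq_sq]
    ring
  refine (h1.ofReal_comp.mul_const (h ξ)).congr_deriv ?_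
  simp only [gaussianSymbol]
  push_cast
  ring

/-- The left side is `m²(1 + 4m²s²) exp(-2m²s²) ‖h ξ‖²`: horizontal derivative and zeroth-order term
make up `m²`, the vertical derivative `4m⁴s²`. -/
theorem gaussianSymbol_energy_le (hh : ContDiff ℝ ∞ h) (k ξ : ℝ) {s : ℝ} (hs : s ≤ 0) :
    ‖(2 * Real.pi * Complex.I * ξ) * gaussianSymbol k h (ξ, s)‖ₑ ^ 2
      + ‖fderiv ℝ (gaussianSymbol k h) (ξ, s) (0, 1)‖ₑ ^ 2
      + ENNReal.ofReal (k ^ 2) * ‖gaussianSymbol k h (ξ, s)‖ₑ ^ 2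
    ≤ ENNReal.ofReal ((1 + freq k ξ * -s) ^ 2)⁻¹ *
      (ENNReal.ofReal (8 * freq k ξ ^ 2) * ‖h ξ‖ₑ ^ 2) := by
  simp only [enorm_sq_eq_ofReal]
  rw [← ENNReal.ofReal_mul (by positivity), ← ENNReal.ofReal_add (by positivity) (by positivity),
    ← ENNReal.ofReal_add (by positivity) (by positivity), ← ENNReal.ofReal_mul (by positivity),
    ← ENNReal.ofReal_mul (by positivity)]
  refine ENNReal.ofReal_le_ofReal ?_
  have hm := freq_nonneg k ξ
  have e := freq_sq k ξ
  set m := freq k ξ with hmdef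
  have h1 := one_add_four_mul_sq_mul_exp_le (m * -s) (mul_nonneg hm (neg_nonneg.2 hs))
  have h2 : Real.exp (-(m ^ 2 * s ^ 2)) ^ 2 = Real.exp (-(2 * (m * -s) ^ 2)) := by
    rw [← Real.exp_nat_mul]
    congr 1
    push_cast
    ring
  have h3 := mul_le_mul_of_nonneg_left h1 (show 0 ≤ m ^ 2 * ‖h ξ‖ ^ 2 by positivity)
  have h4 : ‖(2 * Real.pi * Complex.I * ξ : ℂ)‖ ^ 2 = (2 * Real.pi * ξ) ^ 2 := by
    simp [mul_pow]
  have h5 : ‖gaussianSymbol k h (ξ, s)‖ ^ 2 = Real.exp (-(2 * (m * -s) ^ 2)) * ‖h ξ‖ ^ 2 := by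
    rw [norm_gaussianSymbol, mul_pow, ← hmdef, h2]
  rw [fderiv_gaussianSymbol hh, ← hmdef, norm_mul, mul_pow, norm_mul (Complex.ofReal _), mul_pow,
    h4, h5, Complex.norm_real, Real.norm_eq_abs, sq_abs]
  calc _ = m ^ 2 * ‖h ξ‖ ^ 2 * ((1 + 4 * (m * -s) ^ 2) * Real.exp (-(2 * (m * -s) ^ 2))) := by
        rw [← sub_eq_zero]
        have : k ^ 2 = m ^ 2 - (2 * Real.pi * ξ) ^ 2 := by linarith
        rw [this]
        ring
    _ ≤ _ := h3
    _ = _ := by ring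

theorem lintegral_gaussianSymbol_energy_le (hh : ContDiff ℝ ∞ h) {L : ℝ} (hL : 1 ≤ L) (k : ℝ) :
    ∫⁻ s in Set.Ioo (-L) 0, ∫⁻ ξ, (‖(2 * Real.pi * Complex.I * ξ) * gaussianSymbol k h (ξ, s)‖ₑ ^ 2
      + ‖fderiv ℝ (gaussianSymbol k h) (ξ, s) (0, 1)‖ₑ ^ 2
      + ENNReal.ofReal (k ^ 2) * ‖gaussianSymbol k h (ξ, s)‖ₑ ^ 2)
    ≤ ENNReal.ofReal (8 * L) * dnEnergy k h := by
  have hf := (continuous_freq k).measurable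
  have hhm := hh.continuous.measurable
  calc _ ≤ ∫⁻ s in Set.Ioo (-L) 0, ∫⁻ ξ, ENNReal.ofReal ((1 + freq k ξ * -s) ^ 2)⁻¹ *
          (ENNReal.ofReal (8 * freq k ξ ^ 2) * ‖h ξ‖ₑ ^ 2) :=
        setLIntegral_mono' measurableSet_Ioo fun s hs =>
          lintegral_mono fun ξ => gaussianSymbol_energy_le hh k ξ hs.2.le
    _ = ∫⁻ ξ, ∫⁻ s in Set.Ioo (-L) 0, ENNReal.ofReal ((1 + freq k ξ * -s) ^ 2)⁻¹ *
          (ENNReal.ofReal (8 * freq k ξ ^ 2) * ‖h ξ‖ₑ ^ 2) := by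
        refine lintegral_lintegral_swap (Measurable.aemeasurable ?_)
        simp only [Function.uncurry_def]
        have h1 : Measurable fun p : ℝ × ℝ => freq k p.2 := hf.comp measurable_snd
        have h2 : Measurable fun p : ℝ × ℝ => h p.2 := hhm.comp measurable_snd
        fun_prop
    _ ≤ ∫⁻ ξ, ENNReal.ofReal (8 * L) * ‖(dnMultiplier k ξ : ℂ) * h ξ‖ₑ ^ 2 := by
        refine lintegral_mono fun ξ => ?_
        have hm := freq_nonneg k ξ
        rw [lintegral_mul_const _ (by fun_prop), enorm_mul, mul_pow,
          enorm_sq_eq_ofReal (dnMultiplier k ξ : ℂ), Complex.norm_real, Real.norm_eq_abs, sq_abs,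
          dnMultiplier_sq, ← mul_assoc, ← mul_assoc, ← ENNReal.ofReal_mul (by linarith)]
        refine mul_le_mul_left ((mul_le_mul_left (lintegral_inv_one_add_sq_le hm hL) _).trans ?_) _
        rw [← ENNReal.ofReal_mul (by positivity)]
        refine ENNReal.ofReal_le_ofReal (le_of_eq ?_)
        field_simp
    _ = _ := lintegral_const_mul' _ _ ENNReal.ofReal_ne_top

end GaussianSymbol

theorem lintegral_enorm_sq_add_add {f g h : ℝ → ℂ} (hf : Continuous f) (hg : Continuous g)
    (c : ℝ) :
    ∫⁻ x, (‖f x‖ₑ ^ 2 + ‖g x‖ₑ ^ 2 + ENNReal.ofReal c * ‖h x‖ₑ ^ 2)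
      = (∫⁻ x, ‖f x‖ₑ ^ 2) + (∫⁻ x, ‖g x‖ₑ ^ 2) + ENNReal.ofReal c * ∫⁻ x, ‖h x‖ₑ ^ 2 := by
  rw [lintegral_add_left (by fun_prop), lintegral_add_left (by fun_prop),
    lintegral_const_mul' _ _ ENNReal.ofReal_ne_top]

theorem memLp_two_of_lintegral_lt_top {α : Type*} [MeasurableSpace α] {μ : Measure α} {f : α → ℂ}
    (hf : AEStronglyMeasurable f μ) (h : ∫⁻ p, ‖f p‖ₑ ^ 2 ∂μ < ⊤) : MemLp f 2 μ := by
  refine ⟨hf, ?_⟩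
  rw [eLpNorm_lt_top_iff_lintegral_rpow_enorm_lt_top (by simp) (by simp)]
  simpa using h

theorem dnEnergy_lt_top_of_continuous {h : ℝ → ℂ} (hh : Continuous h) (hc : HasCompactSupport h)
    (k : ℝ) : dnEnergy k h < ⊤ := by
  have hm := continuous_dnMultiplier k
  have h1 : MemLp (fun ξ => (dnMultiplier k ξ : ℂ) * h ξ) 2 volume :=
    Continuous.memLp_of_hasCompactSupport (by fun_prop) hc.mul_left
  have := h1.2
  rw [eLpNorm_lt_top_iff_lintegral_rpow_enorm_lt_top (by simp) (by simp)] at this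
  simpa [dnEnergy] using this

theorem fourierInv_ae_eq_of_ae_eq {u : Lp ℂ 2 (volume : Measure ℝ)} {g : ℝ → ℂ}
    (hg : ContDiff ℝ ∞ g) (hc : HasCompactSupport g) (h : u =ᵐ[volume] g) :
    (𝓕⁻ u : Lp ℂ 2 (volume : Measure ℝ)) =ᵐ[volume] fun x => 𝓕 g (-x) := by
  let f := hc.toSchwartzMap hg
  have hf : (f : ℝ → ℂ) = g := rfl
  have e : u = f.toLp 2 := Lp.ext (h.trans (SchwartzMap.coeFn_toLp f 2 volume).symm)
  rw [e, SchwartzMap.toLp_fourierInv_eq]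
  refine (SchwartzMap.coeFn_toLp _ 2 volume).trans (Eventually.of_forall fun x => ?_)
  rw [SchwartzMap.fourierInv_coe, hf, Real.fourierInv_eq_fourier_neg]

/-- The Gaussian equals `1` at `s = 0`, so the synthesized function has surface value `𝓕⁻ h`; the
inverse shear carries it to the fluid, whose straightened image lies in a strip of height `L`. -/
theorem exists_extension_of_contDiff {η : ℝ → ℝ} (hη : ContDiff ℝ ∞ η) {M L : ℝ}
    (hM : ∀ x, |deriv η x| ≤ M) (hL1 : 1 ≤ L) (hL : ∀ x, 1 + η x ≤ L) (k : ℝ) {h : ℝ → ℂ}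
    (hh : ContDiff ℝ ∞ h) (hc : HasCompactSupport h) {g : Lp ℂ 2 (volume : Measure ℝ)}
    (hg : g =ᵐ[volume] h) :
    ∃ z ∈ traceGraph η, z.2.2.2 = 𝓕⁻ g ∧ ‖energyMap η k z‖ₑ ^ 2 ≤
      ENNReal.ofReal ((2 + 2 * M ^ 2) * (8 * L)) * dnEnergy k h := by
  set A := gaussianSymbol k h with hAdef
  have hA : ContDiff ℝ ∞ A := contDiff_gaussianSymbol k hh
  have hK : IsCompact (tsupport h) := hc
  have hA0 : ∀ s, ∀ ξ ∉ tsupport h, A (ξ, s) = 0 := fun s ξ hξ => by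
    simp [hAdef, gaussianSymbol, image_eq_zero_of_notMem_tsupport hξ]
  set W := synthesis A with hWdef
  have hW : ContDiff ℝ ∞ W := contDiff_synthesis hA hK hA0
  have hη' : ContDiff ℝ ∞ (-η) := hη.neg
  have hM' : ∀ x, |deriv (-η) x| ≤ M := fun x => by
    rw [deriv.neg, abs_neg]
    exact hM x
  have hw : ContDiff ℝ ∞ (W ∘ shear (-η)) := hW.comp (contDiff_shear hη')
  have c0 := hW.continuous
  have c1 := continuous_fderiv_apply_of_contDiff hW (1, 0)
  have c2 := continuous_fderiv_apply_of_contDiff hW (0, 1)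
  have d0 := hw.continuous
  have d1 := continuous_fderiv_apply_of_contDiff hw (1, 0)
  have d2 := continuous_fderiv_apply_of_contDiff hw (0, 1)
  have hstrip : ∫⁻ s in Set.Ioo (-L) 0, ∫⁻ x, (‖fderiv ℝ W (x, s) (1, 0)‖ₑ ^ 2
      + ‖fderiv ℝ W (x, s) (0, 1)‖ₑ ^ 2 + ENNReal.ofReal (k ^ 2) * ‖W (x, s)‖ₑ ^ 2)
      ≤ ENNReal.ofReal (8 * L) * dnEnergy k h := by
    refine le_trans (lintegral_mono fun s => le_of_eq ?_)
      (lintegral_gaussianSymbol_energy_le hh hL1 k)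
    have a1 := contDiff_fderiv_apply hA (0, 1)
    have a2 : ContDiff ℝ ∞ fun p : ℝ × ℝ => (2 * Real.pi * Complex.I * p.1) * A p :=
      (contDiff_const.mul (Complex.ofRealCLM.contDiff.comp contDiff_fst)).mul hA
    have z1 : ∀ s, ∀ ξ ∉ tsupport h, fderiv ℝ A (ξ, s) (0, 1) = 0 := fun s ξ hξ => by
      rw [hAdef, fderiv_gaussianSymbol hh, ← hAdef, hA0 s ξ hξ, mul_zero]
    have z2 : ∀ s, ∀ ξ ∉ tsupport h, (2 * Real.pi * Complex.I * ξ) * A (ξ, s) = 0 :=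
      fun s ξ hξ => by rw [hA0 s ξ hξ, mul_zero]
    refine (lintegral_enorm_sq_add_add (contDiff_slice (contDiff_fderiv_apply hW (1, 0)) s).continuous
      (contDiff_slice (contDiff_fderiv_apply hW (0, 1)) s).continuous _).trans
      (Eq.trans ?_ (lintegral_enorm_sq_add_add (contDiff_slice a2 s).continuous
        (contDiff_slice a1 s).continuous _).symm)
    rw [lintegral_enorm_sq_synthesis hA hK hA0,
      ← lintegral_enorm_sq_synthesis a1 hK z1, ← lintegral_enorm_sq_synthesis a2 hK z2]
    simp only [hWdef, fderiv_synthesis_snd hA hK hA0, fderiv_synthesis_fst hA hK hA0]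
    rfl
  have hmeas : Measurable fun p => ENNReal.ofReal (2 + 2 * M ^ 2) *
      (‖fderiv ℝ W p (1, 0)‖ₑ ^ 2 + ‖fderiv ℝ W p (0, 1)‖ₑ ^ 2
        + ENNReal.ofReal (k ^ 2) * ‖W p‖ₑ ^ 2) := by fun_prop
  have htot : ∫⁻ p in fluidDomain η, (‖fderiv ℝ (W ∘ shear (-η)) p (1, 0)‖ₑ ^ 2
      + ‖fderiv ℝ (W ∘ shear (-η)) p (0, 1)‖ₑ ^ 2
      + ENNReal.ofReal (k ^ 2) * ‖(W ∘ shear (-η)) p‖ₑ ^ 2)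
      ≤ ENNReal.ofReal ((2 + 2 * M ^ 2) * (8 * L)) * dnEnergy k h := by
    refine (lintegral_mono fun p => enorm_fderiv_comp_shear_le hη' hM' hW _ p).trans ?_
    refine (lintegral_fluidDomain_comp_shear_le hη.continuous hL hmeas).trans ?_
    simp only [lintegral_const_mul' _ _ ENNReal.ofReal_ne_top]
    rw [ENNReal.ofReal_mul (by positivity), mul_assoc]
    exact mul_le_mul_right hstrip _
  have hfin := htot.trans_lt (ENNReal.mul_lt_top ENNReal.ofReal_lt_top
    (dnEnergy_lt_top_of_continuous hh.continuous hc k))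
  have m1 : MemLp (fun p => fderiv ℝ (W ∘ shear (-η)) p (1, 0)) 2
      (volume.restrict (fluidDomain η)) :=
    memLp_two_of_lintegral_lt_top d1.aestronglyMeasurable
      ((lintegral_mono fun p => le_self_add.trans le_self_add).trans_lt hfin)
  have m2 : MemLp (fun p => fderiv ℝ (W ∘ shear (-η)) p (0, 1)) 2
      (volume.restrict (fluidDomain η)) :=
    memLp_two_of_lintegral_lt_top d2.aestronglyMeasurable
      ((lintegral_mono fun p => le_add_self.trans le_self_add).trans_lt hfin)
  -- The energy bound does not control the function itself when `k = 0`. Here the symbol is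
  -- dominated by `h` on a strip of finite height.
  have m0 : MemLp (W ∘ shear (-η)) 2 (volume.restrict (fluidDomain η)) := by
    refine memLp_two_of_lintegral_lt_top d0.aestronglyMeasurable ?_
    refine (lintegral_fluidDomain_comp_shear_le hη.continuous hL
      (g := fun p => ‖W p‖ₑ ^ 2) (by fun_prop)).trans_lt ?_
    have hh2 := (hh.continuous.memLp_of_hasCompactSupport (μ := volume) (p := 2) hc).2
    rw [eLpNorm_lt_top_iff_lintegral_rpow_enorm_lt_top (by simp) (by simp)] at hh2
    calc _ ≤ ∫⁻ _ in Set.Ioo (-L) 0, ∫⁻ ξ, ‖h ξ‖ₑ ^ 2 := by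
          refine lintegral_mono fun s => ?_
          simp only [hWdef, lintegral_enorm_sq_synthesis hA hK hA0]
          refine lintegral_mono fun ξ => ?_
          have : ‖A (ξ, s)‖ₑ ≤ ‖h ξ‖ₑ := enorm_le_iff_norm_le.2 (norm_gaussianSymbol_le k ξ s)
          exact pow_le_pow_left' this 2
      _ < ⊤ := by
          rw [setLIntegral_const]
          refine ENNReal.mul_lt_top (by simpa using hh2) (by simp)
  have htr : (𝓕⁻ g : Lp ℂ 2 (volume : Measure ℝ)) =ᵐ[volume]
      fun t => (W ∘ shear (-η)) (t, η t) := by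
    refine (fourierInv_ae_eq_of_ae_eq hh hc hg).trans (Eventually.of_forall fun t => ?_)
    simp [shear, hWdef, synthesis_eq, hAdef, gaussianSymbol]
  refine ⟨(m0.toLp _, m1.toLp _, m2.toLp _, 𝓕⁻ g),
    mem_traceGraph_of_contDiff hη.continuous hw m0.coeFn_toLp m1.coeFn_toLp m2.coeFn_toLp htr,
    rfl, ?_⟩
  rwa [enorm_energyMap_sq_eq_lintegral k m0.coeFn_toLp m1.coeFn_toLp m2.coeFn_toLp d1 d2]

/-! ### Parametrization of `H^{1/2}` by `L²` and density. -/

/-- The weight `(1 + ξ²)^{-1/4}`. -/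
def besselWeight (ξ : ℝ) : ℝ := (1 + ‖ξ‖ ^ 2) ^ (-(1 / 4) : ℝ)

theorem besselWeight_nonneg (ξ : ℝ) : 0 ≤ besselWeight ξ := by
  unfold besselWeight
  positivity

theorem besselWeight_pow_four (ξ : ℝ) : besselWeight ξ ^ 4 = (1 + ξ ^ 2)⁻¹ := by
  rw [besselWeight, ← Real.rpow_natCast, ← Real.rpow_mul (by positivity), Real.norm_eq_abs, sq_abs]
  norm_num [Real.rpow_neg_one]

theorem besselWeight_le_one (ξ : ℝ) : besselWeight ξ ≤ 1 :=
  Real.rpow_le_one_of_one_le_of_nonpos (by nlinarith [sq_nonneg ‖ξ‖]) (by norm_num)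

theorem hasTemperateGrowth_besselWeight :
    Function.HasTemperateGrowth fun ξ : ℝ => (besselWeight ξ : ℂ) := by
  unfold besselWeight
  fun_prop

theorem continuous_besselWeight : Continuous besselWeight := by
  unfold besselWeight
  exact Continuous.rpow_const (by fun_prop) fun ξ => Or.inl (by positivity)

/-- The bound grows with `k`, harmlessly: it only makes the multiplication a bounded operator.
Fourth powers remove the fractional exponents. -/
theorem dnMultiplier_mul_besselWeight_le (k ξ : ℝ) :
    dnMultiplier k ξ * besselWeight ξ ≤ 1 + (2 * Real.pi) ^ 2 + k ^ 2 := by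
  have hm := freq_nonneg k ξ
  have h1 : dnMultiplier k ξ ^ 4 ≤ freq k ξ ^ 2 := by
    have h : dnMultiplier k ξ ^ 2 ≤ freq k ξ := by
      rw [dnMultiplier_sq, div_le_iff₀ (by positivity)]
      nlinarith
    calc dnMultiplier k ξ ^ 4 = (dnMultiplier k ξ ^ 2) ^ 2 := by ring
      _ ≤ _ := by gcongr
  have h2 : (dnMultiplier k ξ * besselWeight ξ) ^ 4 ≤ (2 * Real.pi) ^ 2 + k ^ 2 := by
    rw [mul_pow, besselWeight_pow_four, ← div_eq_mul_inv, div_le_iff₀ (by positivity)]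
    refine h1.trans ?_
    rw [freq_sq]
    nlinarith [sq_nonneg (k * ξ), sq_nonneg Real.pi]
  have h3 : 1 ≤ 1 + (2 * Real.pi) ^ 2 + k ^ 2 := by
    nlinarith [sq_nonneg k, sq_nonneg (2 * Real.pi)]
  refine le_of_pow_le_pow_left₀ (n := 4) (by norm_num) (by linarith) (h2.trans ?_)
  exact le_trans (by linarith) (le_self_pow₀ h3 (by norm_num))

/-- Multiplication by a bounded function on `L²(ℝ)`. -/
def mulL2 {b : ℝ → ℂ} (hb : MemLp b ⊤ (volume : Measure ℝ)) :
    Lp ℂ 2 (volume : Measure ℝ) →L[ℂ] Lp ℂ 2 (volume : Measure ℝ) :=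
  LinearMap.mkContinuous
    { toFun := fun f => (hb.toLp b • f : Lp ℂ 2 (volume : Measure ℝ))
      map_add' := fun f g => by
        refine Lp.ext ?_
        filter_upwards [Lp.coeFn_lpSMul (r := 2) (hb.toLp b) (f + g),
          Lp.coeFn_lpSMul (r := 2) (hb.toLp b) f, Lp.coeFn_lpSMul (r := 2) (hb.toLp b) g,
          Lp.coeFn_add f g, Lp.coeFn_add (hb.toLp b • f : Lp ℂ 2 (volume : Measure ℝ))
            (hb.toLp b • g : Lp ℂ 2 (volume : Measure ℝ))] with x h1 h2 h3 h4 h5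
        rw [h1, h5, Pi.add_apply, h2, h3, Pi.smul_apply', Pi.smul_apply', Pi.smul_apply', h4,
          Pi.add_apply, smul_add]
      map_smul' := fun c f => by
        refine Lp.ext ?_
        filter_upwards [Lp.coeFn_lpSMul (r := 2) (hb.toLp b) (c • f),
          Lp.coeFn_lpSMul (r := 2) (hb.toLp b) f, Lp.coeFn_smul c f,
          Lp.coeFn_smul c (hb.toLp b • f : Lp ℂ 2 (volume : Measure ℝ))] with x h1 h2 h4 h5
        rw [h1, RingHom.id_apply, h5, Pi.smul_apply, h2, Pi.smul_apply', Pi.smul_apply', h4,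
          Pi.smul_apply, smul_comm] }
    ‖hb.toLp b‖ fun f => Lp.norm_smul_le _ _

theorem mulL2_ae_eq {b : ℝ → ℂ} (hb : MemLp b ⊤ (volume : Measure ℝ))
    (f : Lp ℂ 2 (volume : Measure ℝ)) : mulL2 hb f =ᵐ[volume] fun ξ => b ξ * f ξ := by
  filter_upwards [Lp.coeFn_lpSMul (r := 2) (hb.toLp b) f, hb.coeFn_toLp] with x h1 h2
  refine h1.trans ?_
  rw [Pi.smul_apply', h2, smul_eq_mul]

theorem memLp_besselWeight :
    MemLp (fun ξ => (besselWeight ξ : ℂ)) ⊤ (volume : Measure ℝ) :=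
  memLp_top_of_bound (Complex.continuous_ofReal.comp
    continuous_besselWeight).aestronglyMeasurable 1 (Eventually.of_forall fun ξ => by
    rw [Complex.norm_real, Real.norm_of_nonneg (besselWeight_nonneg ξ)]
    exact besselWeight_le_one ξ)

theorem memLp_dnMultiplier_mul_besselWeight (k : ℝ) :
    MemLp (fun ξ => ((dnMultiplier k ξ * besselWeight ξ : ℝ) : ℂ)) ⊤ (volume : Measure ℝ) :=
  memLp_top_of_bound (Complex.continuous_ofReal.comp
    ((continuous_dnMultiplier k).mul continuous_besselWeight)).aestronglyMeasurable
    (1 + (2 * Real.pi) ^ 2 + k ^ 2) (Eventually.of_forall fun ξ => by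
    rw [Complex.norm_real, Real.norm_of_nonneg
      (mul_nonneg (dnMultiplier_nonneg k ξ) (besselWeight_nonneg ξ))]
    exact dnMultiplier_mul_besselWeight_le k ξ)

theorem enorm_mulL2_sq (k : ℝ) (g : Lp ℂ 2 (volume : Measure ℝ)) :
    ‖mulL2 (memLp_dnMultiplier_mul_besselWeight k) g‖ₑ ^ 2
      = dnEnergy k (mulL2 memLp_besselWeight g) := by
  rw [enorm_sq_eq_lintegral (mulL2_ae_eq _ g), dnEnergy_congr (mulL2_ae_eq _ g)]
  refine lintegral_congr fun ξ => ?_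
  rw [Complex.ofReal_mul, mul_assoc]

/-- `H^{1/2}` is parametrized by `g ∈ L²` through `û = (1 + ξ²)^{-1/4} g`. The identity is checked
among tempered distributions, into which `L²` embeds injectively. -/
theorem exists_mulL2_eq_fourier (u : Hhalf) : ∃ g : Lp ℂ 2 (volume : Measure ℝ),
    mulL2 memLp_besselWeight g = 𝓕 (u : Lp ℂ 2 (volume : Measure ℝ)) := by
  obtain ⟨g, hg⟩ := TemperedDistribution.memSobolev_iff_exists_smulLeftCLM_fourier.1 u.2
  refine ⟨g, ?_⟩
  have hinj : Function.Injective (Lp.toTemperedDistributionCLM ℂ (volume : Measure ℝ) 2) :=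
    LinearMap.ker_eq_bot.1 Lp.ker_toTemperedDistributionCLM_eq_bot
  refine hinj ?_
  have h1 := Lp.toTemperedDistribution_smul_eq (r := 2) hasTemperateGrowth_besselWeight
    memLp_besselWeight g
  refine h1.trans ?_
  rw [← hg, TemperedDistribution.smulLeftCLM_smulLeftCLM_apply (by fun_prop)
    hasTemperateGrowth_besselWeight, Lp.fourier_toTemperedDistribution_eq]
  convert! TemperedDistribution.smulLeftCLM_const 1
    ((𝓕 (u : Lp ℂ 2 (volume : Measure ℝ)) : Lp ℂ 2 (volume : Measure ℝ)) :
      TemperedDistribution ℝ ℂ) using 1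
  · congr 2
    ext x
    rw [Pi.mul_apply, besselWeight]
    norm_cast
    rw [← Real.rpow_add (by positivity)]
    norm_num
  · simp

/-- Square integrable functions with a smooth compactly supported representative. -/
def smoothL2 : Submodule ℂ (Lp ℂ 2 (volume : Measure ℝ)) where
  carrier := {f | ∃ g : ℝ → ℂ, f =ᵐ[volume] g ∧ HasCompactSupport g ∧ ContDiff ℝ ∞ g}
  add_mem' := by
    rintro f f' ⟨g, h, hc, hg⟩ ⟨g', h', hc', hg'⟩
    exact ⟨g + g', (Lp.coeFn_add f f').trans (h.add h'), hc.add hc', hg.add hg'⟩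
  zero_mem' := ⟨0, Lp.coeFn_zero _ _ _, HasCompactSupport.zero, contDiff_const⟩
  smul_mem' := by
    rintro c f ⟨g, h, hc, hg⟩
    exact ⟨c • g, (Lp.coeFn_smul c f).trans (h.const_smul c), hc.smul_left (f := fun _ => c),
      hg.const_smul c⟩

theorem contDiff_besselWeight : ContDiff ℝ ∞ fun ξ => (besselWeight ξ : ℂ) :=
  hasTemperateGrowth_besselWeight.1

/-- In terms of `g`, the surface value is a bounded operator and `dnNorm` is the norm of another,
which is the form needed by the density argument. The weight is smooth, so a smooth compactly
supported `g` gives an admissible symbol. -/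
theorem exists_extension {η : ℝ → ℝ} (hη : ContDiff ℝ ∞ η) {a b : ℝ}
    (hP : PoincareInequality η a b) (ha : 0 ≤ a) (hb : 0 ≤ b) {M L : ℝ}
    (hM : ∀ x, |deriv η x| ≤ M) (hL1 : 1 ≤ L) (hL : ∀ x, 1 + η x ≤ L) (k : ℝ) (u : Hhalf) :
    ∃ z ∈ traceGraph η, z.2.2.2 = u ∧
      ‖energyMap η k z‖ ≤ √((2 + 2 * M ^ 2) * (8 * L)) * dnNorm k u := by
  have hC : 0 ≤ (2 + 2 * M ^ 2) * (8 * L) := by positivity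
  obtain ⟨g, hg⟩ := exists_mulL2_eq_fourier u
  let F : Lp ℂ 2 (volume : Measure ℝ) →L[ℂ] Lp ℂ 2 (volume : Measure ℝ) :=
    (Lp.fourierTransformₗᵢ ℝ ℂ).symm.toContinuousLinearEquiv.toContinuousLinearMap
  have key := hP.exists_extension_of_dense ha hb (k := k)
    (Real.sqrt_nonneg ((2 + 2 * M ^ 2) * (8 * L))) (F ∘L mulL2 memLp_besselWeight)
    (mulL2 (memLp_dnMultiplier_mul_besselWeight k)) (S := smoothL2)
    (Lp.dense_hasCompactSupport_contDiff (by simp)) ?_ g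
  · obtain ⟨z, hz, hzu, hze⟩ := key
    refine ⟨z, hz, ?_, ?_⟩
    · rw [hzu, ContinuousLinearMap.comp_apply, hg]
      exact (Lp.fourierTransformₗᵢ ℝ ℂ).symm_apply_apply _
    · have : dnNorm k u ^ 2 = ‖mulL2 (memLp_dnMultiplier_mul_besselWeight k) g‖ ^ 2 := by
        rw [dnNorm_sq, ← hg, ← enorm_mulL2_sq, enorm_sq_eq_ofReal,
          ENNReal.toReal_ofReal (by positivity)]
      have h0 : 0 ≤ dnNorm k u := ENNReal.toReal_nonneg
      rwa [(sq_eq_sq₀ h0 (norm_nonneg _)).1 this]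
  · rintro f ⟨f', hf, hfc, hfs⟩
    have hs := contDiff_besselWeight.mul hfs
    obtain ⟨z, hz, hzu, hze⟩ := exists_extension_of_contDiff hη hM hL1 hL k hs
      (hfc.mul_left (f := fun ξ => (besselWeight ξ : ℂ))) (g := mulL2 memLp_besselWeight f) (by
        filter_upwards [mulL2_ae_eq memLp_besselWeight f, hf] with ξ h1 h2
        rw [h1, h2])
    refine ⟨z, hz, hzu, ?_⟩
    rw [← dnEnergy_congr (f := mulL2 memLp_besselWeight f), ← enorm_mulL2_sq, enorm_sq_eq_ofReal,
      enorm_sq_eq_ofReal, ← ENNReal.ofReal_mul hC,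
      ENNReal.ofReal_le_ofReal_iff (by positivity)] at hze
    · refine le_of_sq_le_sq ?_ (by positivity)
      rwa [mul_pow, Real.sq_sqrt hC]
    · filter_upwards [mulL2_ae_eq memLp_besselWeight f, hf] with ξ h1 h2
      rw [h1, h2]

/-! ### Choice of constants and conclusion. -/

theorem poincareInequality_of_bounded {η : ℝ → ℝ} (hη : Continuous η) {L : ℝ}
    (hpos : ∀ x, -1 ≤ η x) (hL : ∀ x, 1 + η x ≤ L) :
    PoincareInequality η √(2 * L) (2 * L) := fun x hx => by
  have hL0 : 0 ≤ L := by linarith [hpos 0, hL 0]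
  refine le_of_sq_le_sq ((poincare_traceGraph hη hpos hL hx).trans ?_) (by positivity)
  have h1 := Real.sq_sqrt (show 0 ≤ 2 * L by positivity)
  have h2 : 0 ≤ √(2 * L) * ‖x.2.2.2‖ * (2 * L * ‖x.2.2.1‖) := by positivity
  calc _ = √(2 * L) ^ 2 * ‖x.2.2.2‖ ^ 2 + (2 * L * ‖x.2.2.1‖) ^ 2 := by rw [h1]; ring
    _ ≤ _ := by nlinarith

end

theorem mainTheorem8 (η : ℝ → ℝ) (hη : ContDiff ℝ ∞ η)
    (hη_bdd : ∃ M : ℝ, ∀ x, |η x| ≤ M ∧ |deriv η x| ≤ M)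
    (hη_depth : ∃ δ : ℝ, 0 < δ ∧ ∀ x, δ ≤ 1 + η x) :
    -- the elliptic problem is well posed and the operator is well defined
    (∀ (k : ℝ) (u : Hhalf), ∃! φ : FluidH1 η, IsDirichletSolution η k u φ) ∧
    (∀ k : ℝ, IsDirichletNeumann η k (dirichletNeumann η k) ∧
      ∀ G, IsDirichletNeumann η k G → G = dirichletNeumann η k) ∧
    -- symmetry: `(G_k u, v) = (u, G_k v)`
    (∀ (k : ℝ) (u v : Hhalf),
      dirichletNeumann η k u v = conj (dirichletNeumann η k v u)) ∧
    -- strict monotonicity in `|k|`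
    (∀ k₁ k₂ : ℝ, |k₂| < |k₁| → ∀ u : Hhalf, u ≠ 0 →
      (dirichletNeumann η k₂ u u).re < (dirichletNeumann η k₁ u u).re) ∧
    -- two-sided bounds, uniform in `k`
    (∃ c C : ℝ, 0 < c ∧ 0 < C ∧ ∀ k : ℝ,
      (∀ u v : Hhalf, ‖dirichletNeumann η k u v‖ ≤ C * dnNorm k u * dnNorm k v) ∧
      (∀ u : Hhalf, c * dnNorm k u ^ 2 ≤ (dirichletNeumann η k u u).re)) := by
  obtain ⟨M, hM⟩ := hη_bdd
  obtain ⟨δ, hδ, hpos⟩ := hη_depth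
  have hM0 : 0 ≤ M := (abs_nonneg _).trans (hM 0).1
  -- The height `1 + M` also satisfies `1 ≤ L`, which the Gaussian estimate requires.
  have hL : ∀ x, 1 + η x ≤ 1 + M := fun x => by
    linarith [le_abs_self (η x), (hM x).1]
  have hP := poincareInequality_of_bounded hη.continuous (fun x => by linarith [hpos x]) hL
  exact dirichletNeumann_properties_of_bounds hP (Real.sqrt_nonneg _) (by positivity)
    hη.continuous (fun x hx => trace_eq_zero_of_val_eq_zero hη.continuous hδ hpos hx)
    (by positivity) (by positivity)
    (fun k u x hx hu => dnNorm_sq_le_of_mem_traceGraph hη (fun x => (hM x).2) hδ hpos k u hx hu)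
    (fun k u => exists_extension hη hP (Real.sqrt_nonneg _) (by positivity) (fun x => (hM x).2)
      (by linarith) hL k u)
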